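/- **Setting.** An instance consists of a finite non-empty set $N$ of agents, a finite set $M$ of indivisible goods, and for each agent $i$ a valuation $v_i : 2^M \to \mathbb{R}_{\ge 0}$ that is monotone and additive ($v_i(S\cup T)=v_i(S)+v_i(T)$ for disjoint $S,T$). A good $g$ is relevant to $i$ if $v_i(\{g\})\neq 0$. The instance is $(2,\infty)$-bounded: each good is relevant to at most two agents. An allocation gives the agents pairwise disjoint bundles $X_i \subseteq M$; it is complete if every good is allocated. Agent $i$ envies a set $S$ if $v_i(X_i)<v_i(S)$, and, for $\beta\ge 1$, $\beta$-strongly envies $j$ if $\beta v_i(X_i) < v_i(X_j\setminus\{g\})$ for some $g\in X_j$ (strongly envies, if $\beta=1$). An allocation is $\alpha$-EFX if no agent $(1/\alpha)$-strongly envies another, and EFX if this holds for $\alpha=1$. For $S\subseteq M$, let $S_i$ be the set of goods of $S$ relevant to $i$; let $S_{i,j}$, for $i\ne j$, be the set of goods of $S$ relevant to both $i$ and $j$; let $S_{i,i}$ be the set of goods of $S$ relevant to $i$ only. **The algorithm.** A *basic feasible allocation* gives each agent exactly one good, of positive value to her, and has maximum Nash social welfare (geometric mean of the agents' values) among all allocations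 of one good to each agent. The algorithm keeps a set $\tilde N$ of remaining agents with bundles $\tilde X_i$, the set $N^*=N\setminus\tilde N$ of finalized agents with bundles $X^*_i$, and the pool $P$ of unallocated goods. It starts from a basic feasible allocation with $\tilde N=N$. On $\tilde N$ it uses the graph $G_0$ with an edge $i\to j$ ($i\neq j$) if $v_i(\tilde X_j)>0$; the edge is heavy if $v_i(\tilde X_j) > v_i(\tilde X_i)/\sqrt2$ and light otherwise. A cycle of $G_0$ is homogeneous if its edges are all heavy or all light, and heterogeneous otherwise. As long as some rule applies, it applies the first applicable one; choices left open, including ties, are arbitrary. To finalize an agent is to move her to $N^*$ with her new bundle; goods taken from these agents or the pool and not handed out are in the new pool. 1. *If some $i\neq j$ in $\tilde N$ are such that $i$ envies $P_{i,j}$:* take a minimum-size $S\subseteq P_{i,j}$ that is envied by $i$ or by $j$, and give it to one of these two agents who envies it; her old bundle returns to the pool. 2. *If some $i \in\tilde N$ has out-degree $0$ in $G_0$:* finalize $i$ with $P_i$ if $v_i(\tilde X_i)<v_i(P_i)$, and with $\tilde X_i$ otherwise. 3. *If $G_0$ has a 2-cycle $i\to j\to i$:* if $|\tilde N|=2$,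 finalize $i,j$ with a partition $(Y_i,Y_j)$ of $\tilde X_i\cup\tilde X_j\cup P$ that is EFX between $i$ and $j$ and satisfies $v_i(Y_i)\ge v_i(\tilde X_i)$ and $v_j(Y_j)\ge v_j(\tilde X_j)$. If $|\tilde N|\ge 3$, first swap their bundles if they envy each other, and name the two agents so that $j$ does not envy $i$. Put $A=\tilde X_i\cup(P_i\setminus P_{i,j})$, $B=\tilde X_j$, $C=P_j$. Agent $j$ takes the better of $B$ and $C$ by her own valuation. If she takes $B$, then $i$ gets $A$; if she takes $C$, then $i$ takes the better of $A$ and $B$ by her own valuation. Both are finalized. 4. *If $G_0$ has a homogeneous cycle:* if it is heavy, give each agent on it her successor's bundle and reverse the cycle. Then give each pool good relevant to some agent on the cycle to an agent on the cycle to whom it is relevant, namely to $i$ if it is relevant to both ends of an edge $i\to j$ of the (possibly reversed) cycle. Finalize all agents of the cycle. 5. *If $G_0$ has a heterogeneous cycle:* take consecutive $i\to j\to k$ on it with $i\to j$ heavy and $j\to k$ light. If $v_j(P_j)\le v_j(\tilde X_j)/\sqrt2$, finalize $j$ with $\tilde X_j$. Otherwise finalize $j$ with $P_j$ and $i$ with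 $\tilde X_j\cup(P_i\setminus P_{i,j})$. *Final step.* When no rule applies, add the goods left in the pool to the bundle of a last finalized agent (any of them, if several agents were finalized in the same last step), and return $X^*$. **Theorem.** For every $(2,\infty)$-bounded additive instance: (a) There is a complete $(1/\sqrt2)$-EFX allocation. (b) Start the algorithm from any basic feasible allocation. Then every run ends after finitely many updates: there is no infinite run, and whenever a rule applies in a reached state, an update is possible. When no rule applies, all agents are finalized. Some allocation is returned, and every allocation that can be returned is complete and $(1/\sqrt2)$-EFX. In every state reached, the bundles and the pool partition $M$, and the following invariants hold: - (i) $X^*$ is $(1/\sqrt2)$-EFX among the agents of $N^*$; - (ii) $v_i(X^*_i)\ge v_i\bigl(\bigcup_{j\in\tilde N}\tilde X_j\cup P\bigr)/\sqrt2$ for every $i\in N^*$; - (iii) $\tilde X$ is EFX among the agents of $\tilde N$; - (iv) no agent of $\tilde N$ strongly envies an agent of $N^*$; - (v) for every $i\in\tilde N$ there is an agent $j$ (possibly $j=i$) with $\tilde X_i\subseteq M_{i,j}$. -/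

import Mathlib

noncomputable section

open scoped Classical

/-! ## Fair division instances -/

/-- An additive valuation: non-negative, monotone, and additive on disjoint sets of goods. -/
structure IsAdditiveValuation {M : Type*} [DecidableEq M] (u : Finset M → ℝ) : Prop where
  nonneg : ∀ S : Finset M, 0 ≤ u S
  mono : ∀ S T : Finset M, S ⊆ T → u S ≤ u T
  additive : ∀ S T : Finset M, Disjoint S T → u (S ∪ T) = u S + u T

/-- The good `g` is relevant to the agent `i`. -/
def Relevant {N M : Type*} (v : N → Finset M → ℝ) (i : N) (g : M) : Prop :=
  v i {g} ≠ 0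

/-- `(p, q)`-bounded valuations: each good is relevant to at most `p` agents, and any two
distinct agents share at most `q` relevant goods. -/
def IsBounded {N M : Type*} (v : N → Finset M → ℝ) (p q : ℕ∞) : Prop :=
  (∀ g : M, {i : N | Relevant v i g}.encard ≤ p) ∧
  (∀ i j : N, i ≠ j → {g : M | Relevant v i g ∧ Relevant v j g}.encard ≤ q)

/-- The goods of `S` that are relevant to `i`. -/
def relTo {N M : Type*} (v : N → Finset M → ℝ) (S : Finset M) (i : N) : Finset M :=
  {g ∈ S | Relevant v i g}

/-- For `i ≠ j`, the goods of `S` that are relevant to both `i` and `j`; for `i = j`, the goods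
of `S` that are relevant to `i` only. -/
def relToBoth {N M : Type*} (v : N → Finset M → ℝ) (S : Finset M) (i j : N) : Finset M :=
  {g ∈ S | Relevant v i g ∧ Relevant v j g ∧ (i = j → ∀ k : N, Relevant v k g → k = i)}

/-! ## Allocations and envy -/

/-- A complete allocation: the bundles are pairwise disjoint and every good is allocated. -/
def IsCompleteAllocation {N M : Type*} (X : N → Finset M) : Prop :=
  (∀ i j : N, i ≠ j → Disjoint (X i) (X j)) ∧ ∀ g : M, ∃ i : N, g ∈ X i

/-- Agent `i` envies the set of goods `S`. -/
def EnviesSet {N M : Type*} (v : N → Finset M → ℝ) (X : N → Finset M) (i : N)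
    (S : Finset M) : Prop :=
  v i (X i) < v i S

/-- Agent `i` `β`-strongly envies agent `j`. -/
def StronglyEnvies {N M : Type*} [DecidableEq M] (v : N → Finset M → ℝ) (β : ℝ)
    (X : N → Finset M) (i j : N) : Prop :=
  ∃ g ∈ X j, β * v i (X i) < v i (X j \ {g})

/-- `X` is `α`-EFX for the agents in `A` (where `0 < α ≤ 1`): no agent of `A`
`(1 / α)`-strongly envies another agent of `A`. -/
def IsApproxEFXOn {N M : Type*} [DecidableEq M] (v : N → Finset M → ℝ) (α : ℝ) (A : Set N)
    (X : N → Finset M) : Prop :=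
  ∀ i ∈ A, ∀ j ∈ A, i ≠ j → ¬ StronglyEnvies v (1 / α) X i j

/-- `X` is `α`-EFX (where `0 < α ≤ 1`). -/
def IsApproxEFX {N M : Type*} [DecidableEq M] (v : N → Finset M → ℝ) (α : ℝ)
    (X : N → Finset M) : Prop :=
  IsApproxEFXOn v α Set.univ X

/-! ## The state of the algorithm -/

/-- A state of the algorithm. The agents outside `remaining` are the finalized ones; `bundle i`
is the current bundle of `i` while `i` is remaining, and her final bundle afterwards. -/
structure AlgState (N M : Type*) where
  /-- the remaining agents -/
  remaining : Finset N
  /-- the bundles of all agents, remaining or finalized -/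
  bundle : N → Finset M
  /-- the unallocated goods -/
  pool : Finset M
  /-- the agents finalized by the most recent update that finalized some agent -/
  lastFinalized : Finset N

/-- Finalize the agents of `F` with the bundles `Y`. Whatever these agents held, and whatever was
in the pool, is in the new pool unless it is handed out by `Y`. -/
def AlgState.finalize {N M : Type*} [DecidableEq N] [DecidableEq M] (s : AlgState N M)
    (F : Finset N) (Y : N → Finset M) : AlgState N M where
  remaining := s.remaining \ F
  bundle := fun i => if i ∈ F then Y i else s.bundle i
  pool := (s.pool ∪ F.biUnion s.bundle) \ F.biUnion Y
  lastFinalized := F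

/-- Bundles and pool partition the goods. -/
def AlgState.IsPartition {N M : Type*} (s : AlgState N M) : Prop :=
  (∀ i j : N, i ≠ j → Disjoint (s.bundle i) (s.bundle j)) ∧
  (∀ i : N, Disjoint (s.bundle i) s.pool) ∧
  (∀ g : M, g ∈ s.pool ∨ ∃ i : N, g ∈ s.bundle i)

/-- `i → j` is an edge, of weight `v i (X j) / v i (X i)` greater than `α`, of the weighted envy
graph of the bundles of the remaining agents (positive / 0 counts as infinite). -/
def AlgState.Edge {N M : Type*} (s : AlgState N M) (v : N → Finset M → ℝ) (α : ℝ)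
    (i j : N) : Prop :=
  i ∈ s.remaining ∧ j ∈ s.remaining ∧ i ≠ j ∧ α * v i (s.bundle i) < v i (s.bundle j)

/-- An edge is heavy if its weight exceeds `1 / √2`. -/
def AlgState.Heavy {N M : Type*} (s : AlgState N M) (v : N → Finset M → ℝ) (i j : N) : Prop :=
  s.Edge v (1 / √2) i j

/-- A directed cycle of the graph of positive-weight edges, given as the cyclic permutation that
sends each agent on the cycle to her successor and fixes all other agents. -/
def AlgState.IsEnvyCycle {N M : Type*} (s : AlgState N M) (v : N → Finset M → ℝ)
    (σ : Equiv.Perm N) : Prop :=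
  σ.IsCycle ∧ ∀ i : N, σ i ≠ i → s.Edge v 0 i (σ i)

/-- All edges of the cycle `σ` are heavy. -/
def AlgState.AllHeavy {N M : Type*} (s : AlgState N M) (v : N → Finset M → ℝ)
    (σ : Equiv.Perm N) : Prop :=
  ∀ i : N, σ i ≠ i → s.Heavy v i (σ i)

/-- All edges of the cycle `σ` are light. -/
def AlgState.AllLight {N M : Type*} (s : AlgState N M) (v : N → Finset M → ℝ)
    (σ : Equiv.Perm N) : Prop :=
  ∀ i : N, σ i ≠ i → ¬ s.Heavy v i (σ i)

/-! ## The update rules: when they apply, and what they do -/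

/-- Rule 1 applies if some remaining agent `i` envies the goods of the pool that are relevant to
both `i` and another remaining agent `j`. -/
def Rule1Applicable {N M : Type*} (v : N → Finset M → ℝ) (s : AlgState N M) : Prop :=
  ∃ i ∈ s.remaining, ∃ j ∈ s.remaining, i ≠ j ∧
    EnviesSet v s.bundle i (relToBoth v s.pool i j)

/-- Rule 1: a minimum-size set `S` of pool goods relevant to both `i` and `j` that is envied by
`i` or by `j` goes to an agent `r` among them who envies it; she returns her old bundle. -/
def Rule1 {N M : Type*} [DecidableEq N] [DecidableEq M] (v : N → Finset M → ℝ)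
    (s t : AlgState N M) : Prop :=
  ∃ i ∈ s.remaining, ∃ j ∈ s.remaining, i ≠ j ∧
    EnviesSet v s.bundle i (relToBoth v s.pool i j) ∧
    ∃ S ⊆ relToBoth v s.pool i j,
      (∀ T ⊆ relToBoth v s.pool i j,
        EnviesSet v s.bundle i T ∨ EnviesSet v s.bundle j T → S.card ≤ T.card) ∧
      ∃ r : N, (r = i ∨ r = j) ∧ EnviesSet v s.bundle r S ∧
        t = { remaining := s.remaining
              bundle := Function.update s.bundle r S
              pool := (s.pool ∪ s.bundle r) \ S
              lastFinalized := s.lastFinalized }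

/-- Agent `i` is remaining and has out-degree zero in the graph of positive-weight edges. -/
def AlgState.IsSink {N M : Type*} (s : AlgState N M) (v : N → Finset M → ℝ) (i : N) : Prop :=
  i ∈ s.remaining ∧ ∀ j : N, ¬ s.Edge v 0 i j

/-- Rule 2 applies if there is an agent of out-degree zero. -/
def Rule2Applicable {N M : Type*} (v : N → Finset M → ℝ) (s : AlgState N M) : Prop :=
  ∃ i : N, s.IsSink v i

/-- Rule 2: such an agent takes the better one of her bundle and of the pool goods relevant to
her, and is finalized. -/
def Rule2 {N M : Type*} [DecidableEq N] [DecidableEq M] (v : N → Finset M → ℝ)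
    (s t : AlgState N M) : Prop :=
  ∃ i : N, s.IsSink v i ∧
    t = s.finalize {i} (fun _ =>
      if v i (s.bundle i) < v i (relTo v s.pool i) then relTo v s.pool i else s.bundle i)

/-- Rule 3 applies if there is a cycle of length two. -/
def Rule3Applicable {N M : Type*} (v : N → Finset M → ℝ) (s : AlgState N M) : Prop :=
  ∃ i j : N, s.Edge v 0 i j ∧ s.Edge v 0 j i

/-- Rule 3 when `i` and `j` are the only remaining agents: all goods of the two agents and of the
pool are reallocated to them, without strong envy between them and without decreasing the value
of either. -/
def Rule3Two {N M : Type*} [DecidableEq N] [DecidableEq M] (v : N → Finset M → ℝ)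
    (s t : AlgState N M) (i j : N) : Prop :=
  ∃ Y : N → Finset M, Disjoint (Y i) (Y j) ∧
    Y i ∪ Y j = s.bundle i ∪ s.bundle j ∪ s.pool ∧
    ¬ StronglyEnvies v 1 Y i j ∧ ¬ StronglyEnvies v 1 Y j i ∧
    v i (s.bundle i) ≤ v i (Y i) ∧ v j (s.bundle j) ≤ v j (Y j) ∧
    t = s.finalize {i, j} Y

/-- Rule 3 when at least three agents remain. The agents `i` and `j` first swap their bundles if
they envy each other; `Z` is the result, and the names are chosen so that `j` does not envy `i`
in `Z`. Then `j` picks the better one of `B` and `C`; if she picks `C`, then `i` picks the better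
one of `A` and `B`, and otherwise `i` gets `A`. Ties are broken arbitrarily. -/
def Rule3Many {N M : Type*} [DecidableEq N] [DecidableEq M] (v : N → Finset M → ℝ)
    (s t : AlgState N M) (i j : N) : Prop :=
  ∃ Z : N → Finset M,
    Z = (if EnviesSet v s.bundle i (s.bundle j) ∧ EnviesSet v s.bundle j (s.bundle i) then
          s.bundle ∘ Equiv.swap i j else s.bundle) ∧
    ¬ EnviesSet v Z j (Z i) ∧
    ∃ A B C : Finset M,
      A = Z i ∪ (relTo v s.pool i \ relToBoth v s.pool i j) ∧ B = Z j ∧ C = relTo v s.pool j ∧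
      ∃ Y : N → Finset M,
        ((v j C ≤ v j B ∧ Y j = B ∧ Y i = A) ∨
         (v j B ≤ v j C ∧ v i B ≤ v i A ∧ Y j = C ∧ Y i = A) ∨
         (v j B ≤ v j C ∧ v i A ≤ v i B ∧ Y j = C ∧ Y i = B)) ∧
        t = s.finalize {i, j} Y

/-- Rule 3: resolve a cycle of length two. -/
def Rule3 {N M : Type*} [DecidableEq N] [DecidableEq M] (v : N → Finset M → ℝ)
    (s t : AlgState N M) : Prop :=
  ∃ i j : N, s.Edge v 0 i j ∧ s.Edge v 0 j i ∧
    ((s.remaining.card = 2 ∧ Rule3Two v s t i j) ∨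
     (s.remaining.card ≠ 2 ∧ Rule3Many v s t i j))

/-- Rule 4 applies if there is a homogeneous cycle. -/
def Rule4Applicable {N M : Type*} (v : N → Finset M → ℝ) (s : AlgState N M) : Prop :=
  ∃ σ : Equiv.Perm N, s.IsEnvyCycle v σ ∧ (s.AllHeavy v σ ∨ s.AllLight v σ)

/-- Rule 4: if the homogeneous cycle `σ` is heavy, the bundles are rotated, which reverses the
cycle; `Z` and `τ` are the resulting bundles and cycle. Then each pool good `g` that is relevant
to some agent on the cycle goes to an agent `r g` on the cycle to whom it is relevant, namely to
`i` whenever `g` is relevant to both ends of an edge `i → τ i`. All agents on the cycle are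
finalized. -/
def Rule4 {N M : Type*} [Fintype N] [DecidableEq N] [DecidableEq M] (v : N → Finset M → ℝ)
    (s t : AlgState N M) : Prop :=
  ∃ σ : Equiv.Perm N, s.IsEnvyCycle v σ ∧
    ∃ (τ : Equiv.Perm N) (Z : N → Finset M),
      ((s.AllHeavy v σ ∧ τ = σ⁻¹ ∧ Z = s.bundle ∘ σ) ∨
       (s.AllLight v σ ∧ τ = σ ∧ Z = s.bundle)) ∧
      ∃ r : M → N,
        (∀ i ∈ σ.support, ∀ g ∈ relTo v s.pool i, r g ∈ σ.support ∧ Relevant v (r g) g) ∧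
        (∀ i ∈ σ.support, ∀ g ∈ relToBoth v s.pool i (τ i), r g = i) ∧
        t = s.finalize σ.support (fun i => Z i ∪ {g ∈ relTo v s.pool i | r g = i})

/-- Rule 5 applies if there is a heterogeneous cycle. -/
def Rule5Applicable {N M : Type*} (v : N → Finset M → ℝ) (s : AlgState N M) : Prop :=
  ∃ σ : Equiv.Perm N, s.IsEnvyCycle v σ ∧ ¬ (s.AllHeavy v σ ∨ s.AllLight v σ)

/-- Rule 5: let `i → j → k` be consecutive on a heterogeneous cycle with `i → j` heavy and
`j → k` light. If the pool is worth at most `1 / √2` times her bundle to `j`, then `j` is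
finalized as she is. Otherwise `j` gets the pool goods relevant to her, `i` gets the old bundle of
`j` and the pool goods relevant to `i` but not to `j`, and both are finalized. -/
def Rule5 {N M : Type*} [DecidableEq N] [DecidableEq M] (v : N → Finset M → ℝ)
    (s t : AlgState N M) : Prop :=
  ∃ σ : Equiv.Perm N, s.IsEnvyCycle v σ ∧ ¬ (s.AllHeavy v σ ∨ s.AllLight v σ) ∧
    ∃ i j k : N, σ i ≠ i ∧ j = σ i ∧ k = σ j ∧ s.Heavy v i j ∧ ¬ s.Heavy v j k ∧
      ((v j (relTo v s.pool j) ≤ v j (s.bundle j) / √2 ∧ t = s.finalize {j} s.bundle) ∨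
       (¬ v j (relTo v s.pool j) ≤ v j (s.bundle j) / √2 ∧
          ∃ Y : N → Finset M, Y j = relTo v s.pool j ∧
            Y i = s.bundle j ∪ (relTo v s.pool i \ relToBoth v s.pool i j) ∧
            t = s.finalize {i, j} Y))

/-! ## The algorithm -/

/-- `RuleApplicable v k` says when rule `k + 1` applies. -/
def RuleApplicable {N M : Type*} (v : N → Finset M → ℝ) : Fin 5 → AlgState N M → Prop :=
  ![Rule1Applicable v, Rule2Applicable v, Rule3Applicable v, Rule4Applicable v,
    Rule5Applicable v]

/-- `ApplyRule v k` is the effect of rule `k + 1`. -/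
def ApplyRule {N M : Type*} [Fintype N] [DecidableEq N] [DecidableEq M]
    (v : N → Finset M → ℝ) : Fin 5 → AlgState N M → AlgState N M → Prop :=
  ![Rule1 v, Rule2 v, Rule3 v, Rule4 v, Rule5 v]

/-- One iteration of the main loop: apply the first applicable rule. -/
def AlgStep {N M : Type*} [Fintype N] [DecidableEq N] [DecidableEq M]
    (v : N → Finset M → ℝ) (s t : AlgState N M) : Prop :=
  ∃ k : Fin 5, RuleApplicable v k s ∧ (∀ l < k, ¬ RuleApplicable v l s) ∧ ApplyRule v k s t

/-- No rule is applicable. -/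
def AlgHalted {N M : Type*} (v : N → Finset M → ℝ) (s : AlgState N M) : Prop :=
  ∀ k : Fin 5, ¬ RuleApplicable v k s

/-- The Nash social welfare (geometric mean of the values) of giving each agent `i` the single
good `f i`. -/
def nashWelfare {N M : Type*} [Fintype N] (v : N → Finset M → ℝ) (f : N → M) : ℝ :=
  (∏ i : N, v i {f i}) ^ (1 / (Fintype.card N : ℝ))

/-- A basic feasible allocation: it assigns one good to each agent, with the maximum Nash social
welfare among all such allocations, and every agent receives a good of positive value. -/
def IsBasicFeasible {N M : Type*} [Fintype N] (v : N → Finset M → ℝ) (f : N → M) : Prop :=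
  Function.Injective f ∧
  (∀ f₁ : N → M, Function.Injective f₁ → nashWelfare v f₁ ≤ nashWelfare v f) ∧
  ∀ i : N, 0 < v i {f i}

/-- The initial state, for a basic feasible allocation `f`. -/
def initState {N M : Type*} [Fintype N] [Fintype M] [DecidableEq M] (f : N → M) :
    AlgState N M where
  remaining := Finset.univ
  bundle := fun i => {f i}
  pool := Finset.univ \ Finset.univ.image f
  lastFinalized := ∅

/-- The state `s` occurs in a run of the algorithm that starts from `f`. -/
def AlgReachable {N M : Type*} [Fintype N] [DecidableEq N] [Fintype M] [DecidableEq M]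
    (v : N → Finset M → ℝ) (f : N → M) (s : AlgState N M) : Prop :=
  Relation.ReflTransGen (AlgStep v) (initState f) s

/-- `X` is returned by a run of the algorithm that starts from `f`: a state is reached in which
no rule applies, and the goods left in the pool are given to a last finalized agent. -/
def AlgReturns {N M : Type*} [Fintype N] [DecidableEq N] [Fintype M] [DecidableEq M]
    (v : N → Finset M → ℝ) (f : N → M) (X : N → Finset M) : Prop :=
  ∃ s : AlgState N M, AlgReachable v f s ∧ AlgHalted v s ∧
    ∃ i ∈ s.lastFinalized, X = Function.update s.bundle i (s.bundle i ∪ s.pool)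

/-- The five invariants of the algorithm. -/
structure AlgInvariant {N M : Type*} [Fintype M] [DecidableEq M] (v : N → Finset M → ℝ)
    (s : AlgState N M) : Prop where
  /-- the final bundles are `1/√2`-EFX for the finalized agents -/
  finalized_efx : IsApproxEFXOn v (1 / √2) {i | i ∉ s.remaining} s.bundle
  /-- no finalized agent `√2`-envies the union of the remaining bundles and the pool -/
  finalized_union : ∀ i ∉ s.remaining,
    v i (s.remaining.biUnion s.bundle ∪ s.pool) / √2 ≤ v i (s.bundle i)
  /-- the bundles of the remaining agents are EFX for them -/
  remaining_efx : IsApproxEFXOn v 1 {i | i ∈ s.remaining} s.bundle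
  /-- no remaining agent strongly envies a finalized agent -/
  remaining_finalized : ∀ i ∈ s.remaining, ∀ j ∉ s.remaining,
    ¬ StronglyEnvies v 1 s.bundle i j
  /-- the goods of a remaining agent `i` are all relevant to `i` and to one and the same agent -/
  single_type : ∀ i ∈ s.remaining, ∃ j : N, s.bundle i ⊆ relToBoth v Finset.univ i j

end

/-! By invariant (v) and the bound of two agents per good, the bundle of a remaining agent matters
to her and to at most one other agent, so every vertex of the graph of positive-weight edges has
in-degree at most one (`RunInvariant.pred_unique`). Once Rule 2 fails, every out-degree is positive,
and counting makes the graph a disjoint union of cycles (`RunInvariant.succ_unique`): among the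
remaining bundles an agent values at most her own and her successor's. The failure of Rule 1 bounds
the pool goods shared by two remaining agents by the bundle of either (`value_pool_le`). These facts
control all that Rules 2 to 5 hand out or leave behind.

The constant `√2` comes from heterogeneous cycles. Moving to the successor's bundle along a heavy
edge costs a factor of at most `√2`. If the outgoing edge of `j` is light and the pool is worth at
most `1/√2` of her bundle, then the successor's bundle and the pool together are worth at most `1/√2
+ 1/√2 = √2` times her bundle, so she can stop.

`RunInvariant.finalize` isolates what a finalizing rule must verify. Envy between old and new
finalized agents is then automatic: invariant (ii) protects the earlier ones, and invariant (iv) the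
new ones. The invariant also records that the final step is harmless. Rule 3 for the last two agents
needs a separate existence result for EFX partitions, `IsAdditiveValuation.exists_efx_partition`.

Every update shrinks the set of remaining agents or, in Rule 1, raises the total value; no state
recurs, and there are finitely many states. Part (a) needs an initial allocation even if no basic
feasible one exists: each agent receives a private dummy good of tiny value, which is dropped at the
end. -/

namespace IsAdditiveValuation

/-! ### Additive valuations and EFX partitions for two agents -/

variable {M : Type*} [DecidableEq M] {u w : Finset M → ℝ}

theorem empty (hu : IsAdditiveValuation u) : u ∅ = 0 := by
  have h := hu.additive ∅ ∅ (Finset.disjoint_empty_left _)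
  rw [Finset.empty_union] at h
  linarith

theorem union_le (hu : IsAdditiveValuation u) (S T : Finset M) : u (S ∪ T) ≤ u S + u T := by
  have h := hu.additive S (T \ S) Finset.disjoint_sdiff
  rw [Finset.union_sdiff_self_eq_union] at h
  rw [h]
  gcongr
  exact hu.mono _ _ Finset.sdiff_subset

theorem eq_sum (hu : IsAdditiveValuation u) (S : Finset M) : u S = ∑ g ∈ S, u {g} := by
  induction S using Finset.induction_on with
  | empty => simp [hu.empty]
  | insert a S ha ih =>
    rw [Finset.insert_eq, hu.additive _ _ (Finset.disjoint_singleton_left.2 ha),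
      ← Finset.insert_eq, Finset.sum_insert ha, ih]

theorem le_of_relevant (hu : IsAdditiveValuation u) {S T : Finset M}
    (h : ∀ g ∈ S, u {g} ≠ 0 → g ∈ T) : u S ≤ u T := by
  have h0 : u (S \ T) = 0 := by
    rw [hu.eq_sum]
    refine Finset.sum_eq_zero fun g hg => ?_
    rw [Finset.mem_sdiff] at hg
    by_contra hne
    exact hg.2 (h g hg.1 hne)
  calc u S ≤ u (T ∪ S \ T) := hu.mono _ _ (by rw [Finset.union_sdiff_self_eq_union]; exact Finset.subset_union_right)
    _ ≤ u T + u (S \ T) := hu.union_le _ _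
    _ = u T := by rw [h0, add_zero]

theorem sdiff_singleton_le (hu : IsAdditiveValuation u) (S : Finset M) (g : M) :
    u (S \ {g}) ≤ u S :=
  hu.mono _ _ Finset.sdiff_subset

/-- A set of goods has a partition that is EFX in both directions for the valuation `u`, both
parts of which are worth as much as the worse one of two given disjoint sets. -/
theorem exists_efx_cut (hu : IsAdditiveValuation u) {T C D : Finset M} (hC : C ⊆ T) (hD : D ⊆ T)
    (hCD : Disjoint C D) {c : ℝ} (hcC : c ≤ u C) (hcD : c ≤ u D) :
    ∃ a b : Finset M, Disjoint a b ∧ a ∪ b = T ∧ c ≤ u a ∧ c ≤ u b ∧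
      (∀ g ∈ b, u (b \ {g}) ≤ u a) ∧ (∀ g ∈ a, u (a \ {g}) ≤ u b) := by
  have hDC : u D ≤ u (T \ C) :=
    hu.mono _ _ (Finset.subset_sdiff.2 ⟨hD, hCD.symm⟩)
  -- `Q` consists of the possible worse sides of a cut. The most valuable worse side, with ties
  -- broken by size, gives the cut; the tie-break absorbs goods of value zero.
  set Q : Finset (Finset M) := T.powerset.filter fun S => u S ≤ u (T \ S) with hQ
  have hmem : ∀ S, S ∈ Q ↔ S ⊆ T ∧ u S ≤ u (T \ S) := by simp [hQ]
  obtain ⟨S₀, hS₀, hcS₀⟩ : ∃ S ∈ Q, c ≤ u S := by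
    rcases le_total (u C) (u (T \ C)) with h | h
    · exact ⟨C, (hmem _).2 ⟨hC, h⟩, hcC⟩
    · refine ⟨T \ C, (hmem _).2 ⟨Finset.sdiff_subset, ?_⟩, hcD.trans hDC⟩
      rwa [Finset.sdiff_sdiff_eq_self hC]
  obtain ⟨S, hS, hmax⟩ := Q.exists_max_image (fun S => toLex (u S, S.card)) ⟨S₀, hS₀⟩
  have hST := (hmem S).1 hS
  have hcS : c ≤ u S := by
    have := hmax S₀ hS₀
    rw [Prod.Lex.toLex_le_toLex] at this
    rcases this with h | h
    · exact hcS₀.trans h.le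
    · exact hcS₀.trans h.1.le
  refine ⟨S, T \ S, Finset.disjoint_sdiff, Finset.union_sdiff_of_subset hST.1, hcS,
    hcS.trans hST.2, fun g hg => ?_, fun g _ => (hu.sdiff_singleton_le S g).trans hST.2⟩
  by_contra! hlt
  have hg' := Finset.mem_sdiff.1 hg
  have hsub : insert g S ⊆ T := Finset.insert_subset hg'.1 hST.1
  have hcompl : T \ insert g S = (T \ S) \ {g} := by
    ext x; simp only [Finset.mem_sdiff, Finset.mem_insert, Finset.mem_singleton]; tauto
  -- If the better side without `g` still beats `S`, one of two sets contradicts maximality: `insert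
  -- g S` if it is still the worse side, and otherwise its complement, which is worth more than `S`.
  rcases le_or_gt (u (insert g S)) (u ((T \ S) \ {g})) with h | h
  · have := hmax (insert g S) ((hmem _).2 ⟨hsub, by rwa [hcompl]⟩)
    rw [Prod.Lex.toLex_le_toLex] at this
    have hle : u S ≤ u (insert g S) := hu.mono _ _ (Finset.subset_insert _ _)
    rcases this with h' | h'
    · exact absurd h' (not_lt.2 hle)
    · have := h'.2
      simp only [Finset.card_insert_of_notMem hg'.2] at this
      omega
  · have := hmax ((T \ S) \ {g}) ((hmem _).2 ⟨Finset.sdiff_subset.trans Finset.sdiff_subset, by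
      rw [← hcompl, Finset.sdiff_sdiff_eq_self hsub, hcompl]; exact h.le⟩)
    rw [Prod.Lex.toLex_le_toLex] at this
    rcases this with h' | h'
    · exact absurd h' (not_lt.2 hlt.le)
    · exact absurd h'.1 hlt.ne'

/-- A partial EFX allocation between two agents and an unallocated good `g` admit an improvement,
unless the second agent does not envy the first one, and the first one strongly envies the second
one once she gets `g`. -/
theorem efx_improve_or (hu : IsAdditiveValuation u) (hw : IsAdditiveValuation w)
    {a b : Finset M} {g : M} (hab : Disjoint a b) (hga : g ∉ a) (hgb : g ∉ b)
    (heb : ∀ x ∈ a, w (a \ {x}) ≤ w b) :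
    (∃ a' b' : Finset M, Disjoint a' b' ∧ a' ∪ b' ⊆ insert g (a ∪ b) ∧
      (∀ x ∈ b', u (b' \ {x}) ≤ u a') ∧ (∀ x ∈ a', w (a' \ {x}) ≤ w b') ∧
      u a ≤ u a' ∧ w b ≤ w b' ∧
      (u a + w b < u a' + w b' ∨ a.card + b.card < a'.card + b'.card)) ∨
    (w a < w b ∧ ∃ h ∈ insert g b, u a < u (insert g b \ {h})) := by
  by_cases hS : ∃ h ∈ insert g b, u a < u (insert g b \ {h})
  swap
  · push Not at hS
    have hbg := hw.mono _ _ (Finset.subset_insert g b)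
    refine Or.inl ⟨a, insert g b, ?_, ?_, hS, fun x hx => (heb x hx).trans hbg, le_rfl, hbg,
      Or.inr ?_⟩
    · exact Finset.disjoint_insert_right.2 ⟨hga, hab⟩
    · rw [Finset.union_insert]
    · rw [Finset.card_insert_of_notMem hgb]; omega
  obtain ⟨h, hh, hlt⟩ := hS
  have hne : ((insert g b).powerset.filter fun D => u a < u D ∨ w b < w D).Nonempty :=
    ⟨insert g b, by
      simpa using Or.inl (hlt.trans_le (hu.sdiff_singleton_le _ _))⟩
  -- `Z` is a smallest part of `insert g b` that improves on `a` for `u` or on `b` for `w`. If `w`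
  -- gains, she takes `Z`, and minimality rules out strong envy. Otherwise `u` can take `Z` and
  -- leave `a` to `w`, unless `w` prefers `b` to `a`.
  obtain ⟨Z, hZ, hmin⟩ := Finset.exists_min_image _ Finset.card hne
  simp only [Finset.mem_filter, Finset.mem_powerset] at hZ hmin
  have hdis : Disjoint a Z :=
    Disjoint.mono_right hZ.1 (Finset.disjoint_insert_right.2 ⟨hga, hab⟩)
  have hZs : Z ⊆ insert g (a ∪ b) :=
    hZ.1.trans (Finset.insert_subset_insert _ Finset.subset_union_right)
  have has : a ⊆ insert g (a ∪ b) :=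
    Finset.subset_union_left.trans (Finset.subset_insert _ _)
  by_cases hwZ : w b < w Z
  · refine Or.inl ⟨a, Z, hdis, Finset.union_subset has hZs, fun x hx => ?_,
      fun x hx => (heb x hx).trans hwZ.le, le_rfl, hwZ.le, Or.inl (by linarith)⟩
    by_contra! hc
    have h1 := hmin (Z \ {x}) ⟨Finset.sdiff_subset.trans hZ.1, Or.inl hc⟩
    have h2 : (Z \ {x}).card < Z.card :=
      Finset.card_lt_card (Finset.sdiff_ssubset (Finset.singleton_subset_iff.2 hx)
        (Finset.singleton_nonempty x))
    omega
  · have huZ : u a < u Z := hZ.2.resolve_right hwZ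
    push Not at hwZ
    rcases le_or_gt (w b) (w a) with hba | hba
    · exact Or.inl ⟨Z, a, hdis.symm, Finset.union_subset hZs has,
        fun x _ => (hu.sdiff_singleton_le a x).trans huZ.le,
        fun x _ => (hw.sdiff_singleton_le Z x).trans (hwZ.trans hba), huZ.le, hba,
        Or.inl (by linarith)⟩
    · exact Or.inr ⟨hba, h, hh, hlt⟩

/-- A partial EFX allocation between two agents extends to an EFX partition of all goods that is at
least as good for both. -/
theorem exists_efx_partition (hu : IsAdditiveValuation u) (hw : IsAdditiveValuation w)
    {A B T : Finset M} (hAB : Disjoint A B) (hT : A ∪ B ⊆ T)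
    (heA : ∀ x ∈ B, u (B \ {x}) ≤ u A) (heB : ∀ x ∈ A, w (A \ {x}) ≤ w B) :
    ∃ a b : Finset M, Disjoint a b ∧ a ∪ b = T ∧ (∀ x ∈ b, u (b \ {x}) ≤ u a) ∧
      (∀ x ∈ a, w (a \ {x}) ≤ w b) ∧ u A ≤ u a ∧ w B ≤ w b := by
  classical
  set Q : Finset (Finset M × Finset M) := (T.powerset ×ˢ T.powerset).filter fun p =>
    Disjoint p.1 p.2 ∧ (∀ x ∈ p.2, u (p.2 \ {x}) ≤ u p.1) ∧ (∀ x ∈ p.1, w (p.1 \ {x}) ≤ w p.2) ∧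
      u A ≤ u p.1 ∧ w B ≤ w p.2 with hQ
  have hmem : ∀ a b, (a, b) ∈ Q ↔ a ∪ b ⊆ T ∧ Disjoint a b ∧ (∀ x ∈ b, u (b \ {x}) ≤ u a) ∧
      (∀ x ∈ a, w (a \ {x}) ≤ w b) ∧ u A ≤ u a ∧ w B ≤ w b := by
    intro a b
    simp only [hQ, Finset.mem_filter, Finset.mem_product, Finset.mem_powerset,
      Finset.union_subset_iff]
  -- The best partial EFX allocation by total value, then by number of goods allocated. If a good
  -- `g` is left, no improvement exists, so `efx_improve_or` yields its second alternative for both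
  -- orders of the agents.
  obtain ⟨⟨a, b⟩, hab, hmax⟩ := Q.exists_max_image
    (fun p => toLex (u p.1 + w p.2, p.1.card + p.2.card))
    ⟨(A, B), (hmem A B).2 ⟨hT, hAB, heA, heB, le_rfl, le_rfl⟩⟩
  obtain ⟨hsub, hd, hea, heb, huA, hwB⟩ := (hmem a b).1 hab
  by_cases hfull : a ∪ b = T
  · exact ⟨a, b, hd, hfull, hea, heb, huA, hwB⟩
  obtain ⟨g, hgT, hg⟩ := Finset.exists_of_ssubset (hsub.ssubset_of_ne hfull)
  rw [Finset.mem_union, not_or] at hg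
  have hins : insert g (a ∪ b) ⊆ T := Finset.insert_subset hgT hsub
  have hno : ∀ a' b' : Finset M, Disjoint a' b' → a' ∪ b' ⊆ insert g (a ∪ b) →
      (∀ x ∈ b', u (b' \ {x}) ≤ u a') → (∀ x ∈ a', w (a' \ {x}) ≤ w b') →
      u a ≤ u a' → w b ≤ w b' →
      ¬ (u a + w b < u a' + w b' ∨ a.card + b.card < a'.card + b'.card) := by
    intro a' b' h1 h2 h3 h4 h5 h6 h7
    have := hmax (a', b') ((hmem _ _).2
      ⟨h2.trans hins, h1, h3, h4, huA.trans h5, hwB.trans h6⟩)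
    rw [Prod.Lex.toLex_le_toLex] at this
    simp only at this
    rcases this with h | ⟨h, h'⟩
    · linarith
    · rcases h7 with h7 | h7
      · linarith
      · omega
  rcases efx_improve_or hu hw hd hg.1 hg.2 heb with
    ⟨a', b', h1, h2, h3, h4, h5, h6, h7⟩ | ⟨-, h, hh, hlt⟩
  · exact absurd h7 (hno a' b' h1 h2 h3 h4 h5 h6)
  rcases efx_improve_or hw hu hd.symm hg.2 hg.1 hea with
    ⟨b', a', h1, h2, h3, h4, h5, h6, h7⟩ | ⟨-, h', hh', hlt'⟩
  · refine absurd ?_ (hno a' b' h1.symm (by rwa [Finset.union_comm a' b', Finset.union_comm a b])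
      h4 h3 h6 h5)
    rcases h7 with h7 | h7
    · left; linarith
    · right; omega
  -- Cut and choose finishes. For `u`, the disjoint sets `a` and `insert g b \ {h}` are both worth
  -- at least `u a`, so she can cut `T` into two such parts. For `w`, `b` and `insert g a \ {h'}`
  -- show that `T` is worth at least `2 * w b`, so her better part is worth at least `w b`.
  have hbT : insert g b \ {h} ⊆ T := Finset.sdiff_subset.trans
    ((Finset.insert_subset_insert _ Finset.subset_union_right).trans hins)
  have haT : insert g a \ {h'} ⊆ T := Finset.sdiff_subset.trans
    ((Finset.insert_subset_insert _ Finset.subset_union_left).trans hins)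
  obtain ⟨p, q, hpq, hpqT, hp, hq, hep, heq⟩ := hu.exists_efx_cut
    (Finset.subset_union_left.trans hsub) hbT
    (Disjoint.mono_right Finset.sdiff_subset (Finset.disjoint_insert_right.2 ⟨hg.1, hd⟩))
    le_rfl hlt.le
  have hsum : w b + w b ≤ w p + w q := by
    rw [← hw.additive p q hpq, hpqT]
    calc w b + w b ≤ w b + w (insert g a \ {h'}) := by linarith
      _ = w (b ∪ insert g a \ {h'}) := (hw.additive _ _ (Disjoint.mono_right Finset.sdiff_subset
          (Finset.disjoint_insert_right.2 ⟨hg.2, hd.symm⟩))).symm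
      _ ≤ w T := hw.mono _ _ (Finset.union_subset (Finset.subset_union_right.trans hsub) haT)
  rcases le_total (w p) (w q) with hle | hle
  · exact ⟨p, q, hpq, hpqT, hep, fun x _ => (hw.sdiff_singleton_le p x).trans hle,
      huA.trans hp, by linarith⟩
  · exact ⟨q, p, hpq.symm, by rwa [Finset.union_comm], heq,
      fun x _ => (hw.sdiff_singleton_le q x).trans hle, huA.trans hq, by linarith⟩

end IsAdditiveValuation

/-! ### Relevance, the run invariant, and finalizing agents -/

section Basics

variable {N M : Type*} {v : N → Finset M → ℝ}

theorem mem_relTo {S : Finset M} {i : N} {g : M} : g ∈ relTo v S i ↔ g ∈ S ∧ Relevant v i g := by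
  simp [relTo]

theorem mem_relToBoth {S : Finset M} {i j : N} (hij : i ≠ j) {g : M} :
    g ∈ relToBoth v S i j ↔ g ∈ S ∧ Relevant v i g ∧ Relevant v j g := by
  simp [relToBoth, hij]

theorem relToBoth_comm {S : Finset M} {i j : N} (hij : i ≠ j) :
    relToBoth v S i j = relToBoth v S j i := by
  ext g
  rw [mem_relToBoth hij, mem_relToBoth hij.symm]
  tauto

theorem relToBoth_subset {S : Finset M} {i j : N} : relToBoth v S i j ⊆ S := by
  simp [relToBoth]

/-- A good is relevant to at most two agents. -/
theorem IsBounded.eq_or_eq (hb : IsBounded v 2 ⊤) {i j k : N} {g : M} (hij : i ≠ j)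
    (hi : Relevant v i g) (hj : Relevant v j g) (hk : Relevant v k g) : k = i ∨ k = j := by
  by_contra! h
  have h1 : ({i, j, k} : Set N).encard ≤ 2 := by
    refine (Set.encard_le_encard ?_).trans (hb.1 g)
    rintro x (rfl | rfl | rfl)
    exacts [hi, hj, hk]
  rw [Set.encard_eq_three.2 ⟨i, j, k, hij, h.1.symm, h.2.symm, rfl⟩] at h1
  exact absurd h1 (by decide)

variable [DecidableEq M]

theorem not_stronglyEnvies {β : ℝ} {X : N → Finset M} {i j : N} :
    ¬ StronglyEnvies v β X i j ↔ ∀ g ∈ X j, v i (X j \ {g}) ≤ β * v i (X i) := by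
  simp [StronglyEnvies]

theorem isApproxEFXOn_inv_sqrt_two {A : Set N} {X : N → Finset M} :
    IsApproxEFXOn v (1 / √2) A X ↔
      ∀ i ∈ A, ∀ j ∈ A, i ≠ j → ∀ g ∈ X j, v i (X j \ {g}) ≤ √2 * v i (X i) := by
  simp [IsApproxEFXOn, not_stronglyEnvies]

theorem isApproxEFXOn_one {A : Set N} {X : N → Finset M} :
    IsApproxEFXOn v 1 A X ↔
      ∀ i ∈ A, ∀ j ∈ A, i ≠ j → ∀ g ∈ X j, v i (X j \ {g}) ≤ v i (X i) := by
  simp [IsApproxEFXOn, not_stronglyEnvies]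

theorem div_sqrt_two_le_iff {a b : ℝ} : a / √2 ≤ b ↔ a ≤ √2 * b := by
  rw [div_le_iff₀ (by positivity), mul_comm]

theorem le_sqrt_two_mul {a b : ℝ} (hb : 0 ≤ b) (h : a ≤ b) : a ≤ √2 * b :=
  h.trans (le_mul_of_one_le_left hb (Real.one_le_sqrt.2 (by norm_num)))

/-- What holds in every reached state: the goods are partitioned, the invariants hold, and the
leftover goods may be given to a last finalized agent once all agents are finalized. -/
structure RunInvariant [Fintype M] (v : N → Finset M → ℝ) (s : AlgState N M) : Prop where
  isPartition : s.IsPartition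
  invariant : AlgInvariant v s
  lastFinalized_nonempty : (∃ i, i ∉ s.remaining) → s.lastFinalized.Nonempty
  -- The second alternative drops no good from the enlarged bundle, so it yields EFX whichever good
  -- is removed.
  leftover : s.remaining = ∅ → s.pool = ∅ ∨
    ∀ i ∈ s.lastFinalized, ∀ l, l ≠ i → v l (s.bundle i ∪ s.pool) ≤ √2 * v l (s.bundle l)

variable [DecidableEq N]

theorem AlgState.mem_finalize_pool {s : AlgState N M} {F : Finset N} {Y : N → Finset M} {g : M} :
    g ∈ (s.finalize F Y).pool ↔
      (g ∈ s.pool ∨ ∃ i ∈ F, g ∈ s.bundle i) ∧ ∀ i ∈ F, g ∉ Y i := by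
  simp [AlgState.finalize]

theorem AlgState.IsPartition.finalize {s : AlgState N M} (h : s.IsPartition) {F : Finset N}
    {Y : N → Finset M} (hdisj : ∀ i ∈ F, ∀ k ∈ F, i ≠ k → Disjoint (Y i) (Y k))
    (hsub : ∀ i ∈ F, ∀ g ∈ Y i, g ∈ s.pool ∨ ∃ k ∈ F, g ∈ s.bundle k) :
    (s.finalize F Y).IsPartition := by
  obtain ⟨h1, h2, h3⟩ := h
  have hout : ∀ i ∈ F, ∀ k ∉ F, Disjoint (Y i) (s.bundle k) := by
    intro i hi k hk
    rw [Finset.disjoint_left]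
    intro g hg hgk
    rcases hsub i hi g hg with h | ⟨l, hl, hgl⟩
    · exact Finset.disjoint_left.1 (h2 k) hgk h
    · exact Finset.disjoint_left.1 (h1 l k (by rintro rfl; exact hk hl)) hgl hgk
  refine ⟨fun i k hik => ?_, fun i => ?_, fun g => ?_⟩
  · by_cases hi : i ∈ F <;> by_cases hk : k ∈ F <;>
      simp only [AlgState.finalize, hi, hk, if_true, if_false]
    · exact hdisj i hi k hk hik
    · exact hout i hi k hk
    · exact (hout k hk i hi).symm
    · exact h1 i k hik
  · rw [Finset.disjoint_left]
    intro g hg hgp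
    rw [AlgState.mem_finalize_pool] at hgp
    by_cases hi : i ∈ F <;> simp only [AlgState.finalize, hi, if_true, if_false] at hg
    · exact hgp.2 i hi hg
    · rcases hgp.1 with h | ⟨l, hl, hgl⟩
      · exact Finset.disjoint_left.1 (h2 i) hg h
      · exact Finset.disjoint_left.1 (h1 l i (by rintro rfl; exact hi hl)) hgl hg
  · rw [AlgState.mem_finalize_pool]
    by_cases hY : ∃ i ∈ F, g ∈ Y i
    · obtain ⟨i, hi, hg⟩ := hY
      exact Or.inr ⟨i, by simpa [AlgState.finalize, hi] using hg⟩
    · push Not at hY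
      rcases h3 g with h | ⟨i, hg⟩
      · exact Or.inl ⟨Or.inl h, hY⟩
      · by_cases hi : i ∈ F
        · exact Or.inl ⟨Or.inr ⟨i, hi, hg⟩, hY⟩
        · exact Or.inr ⟨i, by simpa [AlgState.finalize, hi] using hg⟩

variable [Fintype M]

/-- Conditions under which finalizing the agents of `F` with the bundles `Y` keeps the
invariants. -/
theorem RunInvariant.finalize (hv : ∀ i, IsAdditiveValuation (v i)) {s : AlgState N M}
    (h : RunInvariant v s) {F : Finset N} {Y : N → Finset M} (hF : F ⊆ s.remaining)
    (hne : F.Nonempty) (hdisj : ∀ i ∈ F, ∀ k ∈ F, i ≠ k → Disjoint (Y i) (Y k))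
    (hsub : ∀ i ∈ F, ∀ g ∈ Y i, g ∈ s.pool ∨ ∃ k ∈ F, g ∈ s.bundle k)
    (hval : ∀ i ∈ F, v i (s.bundle i) ≤ √2 * v i (Y i))
    (hefx : ∀ i ∈ F, ∀ k ∈ F, i ≠ k → ∀ g ∈ Y k, v i (Y k \ {g}) ≤ √2 * v i (Y i))
    (hrest : ∀ i ∈ F, v i ((s.remaining \ F).biUnion s.bundle ∪ (s.finalize F Y).pool) ≤
      √2 * v i (Y i))
    (hrem : ∀ l ∈ s.remaining, l ∉ F → ∀ k ∈ F, ∀ g ∈ Y k,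
      v l (Y k \ {g}) ≤ v l (s.bundle l))
    (hleft : s.remaining = F → (s.finalize F Y).pool = ∅ ∨
      ∀ i ∈ F, ∀ k ∈ F, k ≠ i → v k (Y i ∪ (s.finalize F Y).pool) ≤ √2 * v k (Y k)) :
    RunInvariant v (s.finalize F Y) := by
  obtain ⟨hpart, ⟨inv1, inv2, inv3, inv4, inv5⟩, -, -⟩ := h
  rw [isApproxEFXOn_inv_sqrt_two] at inv1
  rw [isApproxEFXOn_one] at inv3
  simp only [not_stronglyEnvies, one_mul, div_sqrt_two_le_iff] at inv2 inv4
  have hin : ∀ i ∈ F, (s.finalize F Y).bundle i = Y i := fun i hi => by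
    simp [AlgState.finalize, hi]
  have hout : ∀ i ∉ F, (s.finalize F Y).bundle i = s.bundle i := fun i hi => by
    simp [AlgState.finalize, hi]
  have hmemr : ∀ i, i ∈ (s.finalize F Y).remaining ↔ i ∈ s.remaining ∧ i ∉ F := fun i => by
    simp [AlgState.finalize]
  have hnotr : ∀ i, i ∉ (s.finalize F Y).remaining → i ∈ F ∨ (i ∉ F ∧ i ∉ s.remaining) := by
    intro i hi
    rw [hmemr] at hi
    by_cases hiF : i ∈ F
    · exact Or.inl hiF
    · exact Or.inr ⟨hiF, fun h => hi ⟨h, hiF⟩⟩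
  have hYsub : ∀ k ∈ F, Y k ⊆ s.remaining.biUnion s.bundle ∪ s.pool := by
    intro k hk g hg
    rw [Finset.mem_union, Finset.mem_biUnion]
    rcases hsub k hk g hg with h | ⟨l, hl, h⟩
    exacts [Or.inr h, Or.inl ⟨l, hF hl, h⟩]
  have hpsub : (s.finalize F Y).pool ⊆ s.remaining.biUnion s.bundle ∪ s.pool := by
    intro g hg
    rw [Finset.mem_union, Finset.mem_biUnion]
    rcases (AlgState.mem_finalize_pool.1 hg).1 with h | ⟨l, hl, h⟩
    exacts [Or.inr h, Or.inl ⟨l, hF hl, h⟩]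
  have hbU : ((s.finalize F Y).remaining).biUnion (s.finalize F Y).bundle =
      (s.remaining \ F).biUnion s.bundle :=
    Finset.biUnion_congr rfl fun i hi => hout i ((hmemr i).1 hi).2
  refine ⟨hpart.finalize hdisj hsub, ⟨?_, ?_, ?_, ?_, ?_⟩, fun _ => hne, ?_⟩
  · rw [isApproxEFXOn_inv_sqrt_two]
    intro i hi k hk hik
    -- New against old: invariant (iv) with the old bundle, then the loss allowed by `hval`. Old
    -- against new: invariant (ii), as `Y k` is carved out of the remaining bundles and the pool.
    rcases hnotr i hi with hi | ⟨hi, hi'⟩ <;> rcases hnotr k hk with hk | ⟨hk, hk'⟩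
    · rw [hin i hi, hin k hk]
      exact hefx i hi k hk hik
    · rw [hin i hi, hout k hk]
      exact fun g hg => (inv4 i (hF hi) k hk' g hg).trans (hval i hi)
    · rw [hout i hi, hin k hk]
      exact fun g _ => ((hv i).mono _ _ (Finset.sdiff_subset.trans (hYsub k hk))).trans
        (inv2 i hi')
    · rw [hout i hi, hout k hk]
      exact inv1 i hi' k hk' hik
  · intro i hi
    rw [div_sqrt_two_le_iff, hbU]
    rcases hnotr i hi with hi | ⟨hi, hi'⟩
    · rw [hin i hi]
      exact hrest i hi
    · rw [hout i hi]
      refine ((hv i).mono _ _ (Finset.union_subset ?_ hpsub)).trans (inv2 i hi')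
      exact (Finset.biUnion_subset_biUnion_of_subset_left _ Finset.sdiff_subset).trans
        Finset.subset_union_left
  · rw [isApproxEFXOn_one]
    intro i hi k hk
    have hi' := (hmemr i).1 hi
    have hk' := (hmemr k).1 hk
    rw [hout i hi'.2, hout k hk'.2]
    exact inv3 i hi'.1 k hk'.1
  · intro i hi k hk
    have hi' := (hmemr i).1 hi
    rw [not_stronglyEnvies, one_mul, hout i hi'.2]
    rcases hnotr k hk with hk | ⟨hk, hk'⟩
    · rw [hin k hk]
      exact hrem i hi'.1 hi'.2 k hk
    · rw [hout k hk]
      exact inv4 i hi'.1 k hk'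
  · intro i hi
    have hi' := (hmemr i).1 hi
    rw [hout i hi'.2]
    exact inv5 i hi'.1
  · intro hemp
    have hrF : s.remaining = F :=
      Finset.Subset.antisymm (Finset.sdiff_eq_empty_iff_subset.1 hemp) hF
    refine (hleft hrF).imp id fun hl i hi l hli => ?_
    have hi : i ∈ F := hi
    rw [hin i hi]
    by_cases hlF : l ∈ F
    · rw [hin l hlF]
      exact hl i hi l hlF hli
    · rw [hout l hlF]
      exact ((hv l).mono _ _ (Finset.union_subset (hYsub i hi) hpsub)).trans
        (inv2 l (by rwa [hrF]))

end Basics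

/-! ### The graph on the remaining agents -/

section Graph

variable {N M : Type*} {v : N → Finset M → ℝ} {s : AlgState N M}

theorem AlgState.edge_zero {i j : N} : s.Edge v 0 i j ↔
    i ∈ s.remaining ∧ j ∈ s.remaining ∧ i ≠ j ∧ 0 < v i (s.bundle j) := by
  simp [AlgState.Edge]

/-- The only consequence of the failure of Rule 1 that the other rules use. -/
theorem value_pool_le (h1 : ¬ Rule1Applicable v s) {i k : N} (hi : i ∈ s.remaining)
    (hk : k ∈ s.remaining) (hik : i ≠ k) :
    v i (relToBoth v s.pool i k) ≤ v i (s.bundle i) := by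
  by_contra! hlt
  exact h1 ⟨i, hi, k, hk, hik, hlt⟩

theorem AlgState.Heavy.value_lt {i j : N} (h : s.Heavy v i j) :
    v i (s.bundle i) < √2 * v i (s.bundle j) := by
  have := h.2.2.2
  rwa [one_div, inv_mul_lt_iff₀ (by positivity)] at this

theorem AlgState.sqrt_two_mul_le_of_not_heavy {i j : N} (he : s.Edge v 0 i j)
    (h : ¬ s.Heavy v i j) : √2 * v i (s.bundle j) ≤ v i (s.bundle i) := by
  by_contra! hlt
  refine h ⟨he.1, he.2.1, he.2.2.1, ?_⟩
  rwa [one_div, inv_mul_lt_iff₀ (by positivity)]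

variable [DecidableEq M]

theorem edge_of_relevant (hv : ∀ i, IsAdditiveValuation (v i)) {i k : N}
    (hi : i ∈ s.remaining) (hk : k ∈ s.remaining) (hik : i ≠ k) {g : M} (hg : g ∈ s.bundle k)
    (hr : Relevant v i g) : s.Edge v 0 i k := by
  refine AlgState.edge_zero.2 ⟨hi, hk, hik, ?_⟩
  exact (lt_of_le_of_ne ((hv i).nonneg _) (Ne.symm hr)).trans_le
    ((hv i).mono _ _ (Finset.singleton_subset_iff.2 hg))

variable [Fintype M]

/-- An edge provides one good of `k` that is relevant to `i`. Hence the second agent named by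
invariant (v) for `k` cannot be `k` herself, and two-boundedness forces her to be `i`; the whole
bundle is then shared by `i` and `k`. -/
theorem RunInvariant.relevant_of_edge (hv : ∀ i, IsAdditiveValuation (v i))
    (hb : IsBounded v 2 ⊤) (h : RunInvariant v s) {i k : N} (he : s.Edge v 0 i k) {g : M}
    (hg : g ∈ s.bundle k) : Relevant v i g ∧ Relevant v k g := by
  obtain ⟨-, hk, hik, hpos⟩ := AlgState.edge_zero.1 he
  obtain ⟨g', hg', hr'⟩ : ∃ g' ∈ s.bundle k, Relevant v i g' := by
    by_contra! hno
    have : v i (s.bundle k) ≤ v i ∅ := (hv i).le_of_relevant fun x hx hxr => absurd hxr (hno x hx)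
    rw [(hv i).empty] at this
    linarith
  obtain ⟨j, hj⟩ := h.invariant.single_type k hk
  have hkj : k ≠ j := by
    rintro rfl
    have := hj hg'
    simp only [relToBoth, Finset.mem_filter] at this
    exact hik (this.2.2.2 trivial i hr')
  have h1 := (mem_relToBoth hkj).1 (hj hg')
  have h2 := (mem_relToBoth hkj).1 (hj hg)
  rcases hb.eq_or_eq hkj h1.2.1 h1.2.2 hr' with rfl | rfl
  · exact absurd rfl hik
  · exact ⟨h2.2.2, h2.2.1⟩

theorem RunInvariant.eq_or_eq_of_edge (hv : ∀ i, IsAdditiveValuation (v i))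
    (hb : IsBounded v 2 ⊤) (h : RunInvariant v s) {i k l : N} (he : s.Edge v 0 i k) {g : M}
    (hg : g ∈ s.bundle k) (hl : Relevant v l g) : l = i ∨ l = k :=
  hb.eq_or_eq he.2.2.1 (h.relevant_of_edge hv hb he hg).1 (h.relevant_of_edge hv hb he hg).2 hl

/-- A good of `k` already has `i` and `k` as its two interested agents, which leaves no room for
another predecessor. -/
theorem RunInvariant.pred_unique (hv : ∀ i, IsAdditiveValuation (v i))
    (hb : IsBounded v 2 ⊤) (h : RunInvariant v s) {i i' k : N} (he : s.Edge v 0 i k)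
    (he' : s.Edge v 0 i' k) : i' = i := by
  obtain ⟨g, hg⟩ : (s.bundle k).Nonempty := by
    by_contra! hemp
    have := (AlgState.edge_zero.1 he).2.2.2
    rw [hemp, (hv i).empty] at this
    exact lt_irrefl _ this
  rcases h.eq_or_eq_of_edge hv hb he hg (h.relevant_of_edge hv hb he' hg).1 with h | h
  · exact h
  · exact absurd h he'.2.2.1

theorem RunInvariant.exists_succ (hv : ∀ i, IsAdditiveValuation (v i))
    (hb : IsBounded v 2 ⊤) (h : RunInvariant v s) (h2 : ¬ Rule2Applicable v s) :
    ∃ f : s.remaining → s.remaining, Function.Injective f ∧ ∀ i : s.remaining, s.Edge v 0 i (f i) := by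
  have hex : ∀ i : s.remaining, ∃ j : s.remaining, s.Edge v 0 i j := by
    intro i
    by_contra! hno
    exact h2 ⟨i, i.2, fun j hj => hno ⟨j, hj.2.1⟩ hj⟩
  choose f hf using hex
  exact ⟨f, fun a b hab => Subtype.ext (h.pred_unique hv hb (hf b) (hab ▸ hf a)), hf⟩

/-- If every remaining agent has a successor, then successors are unique: the graph is a disjoint
union of cycles. -/
theorem RunInvariant.succ_unique (hv : ∀ i, IsAdditiveValuation (v i))
    (hb : IsBounded v 2 ⊤) (h : RunInvariant v s) (h2 : ¬ Rule2Applicable v s) {i j j' : N}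
    (he : s.Edge v 0 i j) (he' : s.Edge v 0 i j') : j' = j := by
  obtain ⟨f, hinj, hf⟩ := h.exists_succ hv hb h2
  have hsurj := Finite.surjective_of_injective hinj
  -- An injective choice of successors is onto by finiteness, so any target `j` is the chosen
  -- successor of some agent, who must be `i` because predecessors are unique.
  have key : ∀ j, s.Edge v 0 i j → j = f ⟨i, he.1⟩ := by
    intro j hj
    obtain ⟨a, ha⟩ := hsurj ⟨j, hj.2.1⟩
    have h1 := hf a
    rw [ha] at h1
    have : (⟨i, he.1⟩ : s.remaining) = a := Subtype.ext (h.pred_unique hv hb h1 hj)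
    rw [this, ha]
  rw [key j he, key j' he']

end Graph

/-! ### Rules 1 and 2 keep the invariant -/

section Rules

variable {N M : Type*} [DecidableEq N] [Fintype M] [DecidableEq M] {v : N → Finset M → ℝ}
  {s t : AlgState N M}

/-- Only the two agents sharing the goods of `S` value them. The receiver `r` improves, and
minimality of `S` keeps the other agent `q` from strongly envying her. -/
theorem Rule1.runInvariant (hv : ∀ i, IsAdditiveValuation (v i)) (hb : IsBounded v 2 ⊤)
    (h : RunInvariant v s) (hst : Rule1 v s t) : RunInvariant v t := by
  obtain ⟨r, q, S, hr, hq, hrq, hS, henv, hqS, rfl⟩ : ∃ (r q : N) (S : Finset M),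
      r ∈ s.remaining ∧ q ∈ s.remaining ∧ r ≠ q ∧ S ⊆ relToBoth v s.pool r q ∧
      v r (s.bundle r) < v r S ∧ (∀ g ∈ S, v q (S \ {g}) ≤ v q (s.bundle q)) ∧
      t = { remaining := s.remaining
            bundle := Function.update s.bundle r S
            pool := (s.pool ∪ s.bundle r) \ S
            lastFinalized := s.lastFinalized } := by
    obtain ⟨i, hi, j, hj, hij, -, S, hS, hmin, r, hr, henv, rfl⟩ := hst
    have hcard : ∀ g ∈ S, (S \ {g}).card < S.card := fun g hg =>
      Finset.card_lt_card (Finset.sdiff_ssubset (Finset.singleton_subset_iff.2 hg)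
        (Finset.singleton_nonempty g))
    have hle : ∀ g ∈ S, v i (S \ {g}) ≤ v i (s.bundle i) ∧ v j (S \ {g}) ≤ v j (s.bundle j) := by
      intro g hg
      refine ⟨?_, ?_⟩ <;> by_contra! hlt
      · exact absurd (hmin _ (Finset.sdiff_subset.trans hS) (Or.inl hlt)) (not_le.2 (hcard g hg))
      · exact absurd (hmin _ (Finset.sdiff_subset.trans hS) (Or.inr hlt)) (not_le.2 (hcard g hg))
    rcases hr with rfl | rfl
    · exact ⟨r, j, S, hi, hj, hij, hS, henv, fun g hg => (hle g hg).2, rfl⟩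
    · exact ⟨r, i, S, hj, hi, hij.symm, by rwa [relToBoth_comm hij.symm], henv,
        fun g hg => (hle g hg).1, rfl⟩
  obtain ⟨⟨p1, p2, p3⟩, ⟨inv1, inv2, inv3, inv4, inv5⟩, hlast, -⟩ := h
  have hSp : S ⊆ s.pool := hS.trans relToBoth_subset
  have hbr : Function.update s.bundle r S r = S := Function.update_self ..
  have hbo : ∀ i, i ≠ r → Function.update s.bundle r S i = s.bundle i := fun i hi =>
    Function.update_of_ne hi ..
  have hSd : ∀ i, Disjoint (s.bundle i) S := fun i => Disjoint.mono_right hSp (p2 i)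
  have hrn : ∀ i, i ∉ s.remaining → i ≠ r := fun i hi hir => hi (hir ▸ hr)
  rw [isApproxEFXOn_inv_sqrt_two] at inv1
  rw [isApproxEFXOn_one] at inv3
  simp only [not_stronglyEnvies, one_mul] at inv4
  refine ⟨⟨fun i k hik => ?_, fun i => ?_, fun g => ?_⟩, ⟨?_, ?_, ?_, ?_, ?_⟩, hlast,
    fun hemp => absurd hr (by rw [show s.remaining = ∅ from hemp]; simp)⟩
  · dsimp only
    by_cases hi : i = r
    · subst hi
      rw [hbr, hbo k hik.symm]
      exact (hSd k).symm
    · by_cases hk : k = r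
      · subst hk
        rw [hbr, hbo i hi]
        exact hSd i
      · rw [hbo i hi, hbo k hk]
        exact p1 i k hik
  · dsimp only
    by_cases hi : i = r
    · subst hi
      rw [hbr]
      exact Finset.disjoint_sdiff
    · rw [hbo i hi]
      exact Disjoint.mono_right Finset.sdiff_subset
        (Finset.disjoint_union_right.2 ⟨p2 i, p1 i r hi⟩)
  · dsimp only
    by_cases hgS : g ∈ S
    · exact Or.inr ⟨r, by rwa [hbr]⟩
    · rcases p3 g with hg | ⟨i, hg⟩
      · exact Or.inl (Finset.mem_sdiff.2 ⟨Finset.mem_union_left _ hg, hgS⟩)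
      · by_cases hi : i = r
        · subst hi
          exact Or.inl (Finset.mem_sdiff.2 ⟨Finset.mem_union_right _ hg, hgS⟩)
        · exact Or.inr ⟨i, by rwa [hbo i hi]⟩
  · rw [isApproxEFXOn_inv_sqrt_two]
    intro i hi k hk hik
    dsimp only
    rw [hbo i (hrn i hi), hbo k (hrn k hk)]
    exact inv1 i hi k hk hik
  · intro i hi
    dsimp only at hi ⊢
    rw [hbo i (hrn i hi)]
    refine le_trans ?_ (inv2 i hi)
    gcongr
    refine (hv i).mono _ _ fun g hg => ?_
    simp only [Finset.mem_union, Finset.mem_biUnion, Finset.mem_sdiff] at hg ⊢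
    rcases hg with ⟨k, hk, hg⟩ | ⟨hg | hg, -⟩
    · by_cases hkr : k = r
      · subst hkr
        rw [hbr] at hg
        exact Or.inr (hSp hg)
      · rw [hbo k hkr] at hg
        exact Or.inl ⟨k, hk, hg⟩
    · exact Or.inr hg
    · exact Or.inl ⟨r, hr, hg⟩
  · rw [isApproxEFXOn_one]
    intro i hi k hk hik g hg
    dsimp only at hg ⊢
    by_cases hkr : k = r
    · subst hkr
      rw [hbr] at hg ⊢
      rw [hbo i hik]
      by_cases hiq : i = q
      · subst hiq
        exact hqS g hg
      · refine (hv i).le_of_relevant fun x hx hxr => ?_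
        have hx' := (mem_relToBoth hrq).1 (hS (Finset.sdiff_subset hx))
        rcases hb.eq_or_eq hrq hx'.2.1 hx'.2.2 hxr with h | h
        · exact absurd h hik
        · exact absurd h hiq
    · rw [hbo k hkr] at hg ⊢
      have := inv3 i hi k hk hik g hg
      by_cases hir : i = r
      · subst hir
        rw [hbr]
        exact this.trans henv.le
      · rwa [hbo i hir]
  · intro i hi k hk
    rw [not_stronglyEnvies, one_mul]
    dsimp only at hi hk ⊢
    rw [hbo k (hrn k hk)]
    intro g hg
    have := inv4 i hi k hk g hg
    by_cases hir : i = r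
    · subst hir
      rw [hbr]
      exact this.trans henv.le
    · rwa [hbo i hir]
  · intro i hi
    dsimp only at hi ⊢
    by_cases hir : i = r
    · subst hir
      rw [hbr]
      refine ⟨q, fun g hg => ?_⟩
      have := (mem_relToBoth hrq).1 (hS hg)
      exact (mem_relToBoth hrq).2 ⟨Finset.mem_univ g, this.2⟩
    · rw [hbo i hir]
      exact inv5 i hi

/-- A sink values no other remaining bundle, so what she values among the goods left is the option
she declined. The others do not strongly envy her by invariant (iii) if she keeps her bundle, and by
the failure of Rule 1 if she takes pool goods. -/
theorem Rule2.runInvariant (hv : ∀ i, IsAdditiveValuation (v i))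
    (h : RunInvariant v s) (h1 : ¬ Rule1Applicable v s) (hst : Rule2 v s t) :
    RunInvariant v t := by
  obtain ⟨i, ⟨hi, hsink⟩, rfl⟩ := hst
  set Z := if v i (s.bundle i) < v i (relTo v s.pool i) then relTo v s.pool i else s.bundle i
    with hZ
  have hZcase : (Z = relTo v s.pool i ∧ v i (s.bundle i) ≤ v i Z) ∨
      (Z = s.bundle i ∧ v i (relTo v s.pool i) ≤ v i Z) := by
    by_cases hlt : v i (s.bundle i) < v i (relTo v s.pool i)
    · rw [if_pos hlt] at hZ
      exact Or.inl ⟨hZ, hZ ▸ hlt.le⟩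
    · rw [if_neg hlt] at hZ
      exact Or.inr ⟨hZ, hZ ▸ not_lt.1 hlt⟩
  have hge : v i (s.bundle i) ≤ v i Z := by
    rcases hZcase with h | h
    · exact h.2
    · rw [h.1]
  have hnonneg := (hv i).nonneg Z
  refine h.finalize hv (Finset.singleton_subset_iff.2 hi) (Finset.singleton_nonempty i) ?_ ?_ ?_ ?_
    ?_ ?_ ?_
  · simp +contextual
  · rcases hZcase with h | h <;> simp +contextual [h.1, mem_relTo]
  · simpa using le_sqrt_two_mul hnonneg hge
  · simp +contextual
  · simp only [Finset.mem_singleton, forall_eq]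
    refine le_sqrt_two_mul hnonneg ?_
    have hpool : ∀ g, g ∈ s.pool ∨ g ∈ s.bundle i → g ∉ Z → Relevant v i g →
        (Z = relTo v s.pool i → g ∈ s.bundle i) ∧ (Z = s.bundle i → g ∈ relTo v s.pool i) := by
      intro g hg hgZ hr
      refine ⟨fun hz => hg.resolve_left fun hp => hgZ ?_, fun hz =>
        mem_relTo.2 ⟨hg.resolve_right fun hp => hgZ ?_, hr⟩⟩
      · rw [hz]; exact mem_relTo.2 ⟨hp, hr⟩
      · rwa [hz]
    have hmem : ∀ g ∈ (s.remaining \ {i}).biUnion s.bundle ∪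
        (s.finalize {i} fun _ => Z).pool, Relevant v i g →
        (g ∈ s.pool ∨ g ∈ s.bundle i) ∧ g ∉ Z := by
      intro g hg hr
      rw [Finset.mem_union] at hg
      rcases hg with hg | hg
      · obtain ⟨k, hk, hg⟩ := Finset.mem_biUnion.1 hg
        rw [Finset.mem_sdiff, Finset.mem_singleton] at hk
        exact absurd (edge_of_relevant hv hi hk.1 (Ne.symm hk.2) hg hr) (hsink k)
      · simpa using AlgState.mem_finalize_pool.1 hg
    rcases hZcase with ⟨hz, hz'⟩ | ⟨hz, hz'⟩
    · refine le_trans ((hv i).le_of_relevant fun g hg hr => ?_) hz'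
      exact (hpool g (hmem g hg hr).1 (hmem g hg hr).2 hr).1 hz
    · refine le_trans ((hv i).le_of_relevant fun g hg hr => ?_) hz'
      exact (hpool g (hmem g hg hr).1 (hmem g hg hr).2 hr).2 hz
  · simp only [Finset.mem_singleton, forall_eq]
    intro l hl hli g hg
    rcases hZcase with ⟨hz, -⟩ | ⟨hz, -⟩
    · refine le_trans ((hv l).le_of_relevant fun x hx hr => ?_) (value_pool_le h1 hl hi hli)
      have hx' := Finset.sdiff_subset hx
      rw [hz, mem_relTo] at hx'
      exact (mem_relToBoth hli).2 ⟨hx'.1, hr, hx'.2⟩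
    · rw [hz] at hg ⊢
      exact isApproxEFXOn_one.1 h.invariant.remaining_efx l hl i hi hli g hg
  · intro _
    refine Or.inr ?_
    simp +contextual

end Rules

/-! ### Rules 3 and 5 keep the invariant -/

section CycleRules

variable {N M : Type*} [DecidableEq M] {v : N → Finset M → ℝ} {s t : AlgState N M}

/-- Supplies invariant (iv) for new bundles: an outsider `l` values only pool goods in them, all
shared with one and the same agent `m`. -/
theorem value_sdiff_le_of_subset_pool (hv : ∀ i, IsAdditiveValuation (v i))
    (h1 : ¬ Rule1Applicable v s) {l m : N} (hl : l ∈ s.remaining) (hm : m ∈ s.remaining)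
    (hlm : l ≠ m) {Y : Finset M} (hY : ∀ x ∈ Y, Relevant v l x → x ∈ s.pool ∧ Relevant v m x)
    (g : M) : v l (Y \ {g}) ≤ v l (s.bundle l) :=
  (((hv l).sdiff_singleton_le Y g).trans ((hv l).le_of_relevant fun x hx hr =>
    (mem_relToBoth hlm).2 ⟨(hY x hx hr).1, hr, (hY x hx hr).2⟩)).trans (value_pool_le h1 hl hm hlm)

variable [Fintype M]

/-- The bundle of an agent other than `i` and the successor of `i` is irrelevant to `i`. -/
theorem RunInvariant.not_relevant (hv : ∀ i, IsAdditiveValuation (v i))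
    (hb : IsBounded v 2 ⊤) (h : RunInvariant v s) (h2 : ¬ Rule2Applicable v s) {i j k : N}
    (he : s.Edge v 0 i j) (hk : k ∈ s.remaining) (hki : k ≠ i) (hkj : k ≠ j) {g : M}
    (hg : g ∈ s.bundle k) : ¬ Relevant v i g := fun hr =>
  hkj (h.succ_unique hv hb h2 he (edge_of_relevant hv he.1 hk hki.symm hg hr))

variable [DecidableEq N]

/-- `RunInvariant.finalize` for two agents. The sets `Ri` and `Rj` contain the goods that are left
and relevant to `i` and `j`, respectively. -/
theorem RunInvariant.finalize_pair (hv : ∀ i, IsAdditiveValuation (v i)) (h : RunInvariant v s)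
    {i j : N} (hi : i ∈ s.remaining) (hj : j ∈ s.remaining) {Y : N → Finset M}
    (hd : Disjoint (Y i) (Y j))
    (hsub : ∀ g, g ∈ Y i ∨ g ∈ Y j → g ∈ s.pool ∨ g ∈ s.bundle i ∨ g ∈ s.bundle j)
    (hvali : v i (s.bundle i) ≤ √2 * v i (Y i)) (hvalj : v j (s.bundle j) ≤ √2 * v j (Y j))
    (hefxi : ∀ g ∈ Y j, v i (Y j \ {g}) ≤ √2 * v i (Y i))
    (hefxj : ∀ g ∈ Y i, v j (Y i \ {g}) ≤ √2 * v j (Y j))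
    {Ri Rj : Finset M} (hRi : v i Ri ≤ √2 * v i (Y i)) (hRj : v j Rj ≤ √2 * v j (Y j))
    (hRi' : ∀ g, g ∉ Y i → g ∉ Y j → (g ∈ s.pool ∨ g ∈ s.bundle i ∨ g ∈ s.bundle j) ∨
      (∃ l ∈ s.remaining, l ≠ i ∧ l ≠ j ∧ g ∈ s.bundle l) → Relevant v i g → g ∈ Ri)
    (hRj' : ∀ g, g ∉ Y i → g ∉ Y j → (g ∈ s.pool ∨ g ∈ s.bundle i ∨ g ∈ s.bundle j) ∨
      (∃ l ∈ s.remaining, l ≠ i ∧ l ≠ j ∧ g ∈ s.bundle l) → Relevant v j g → g ∈ Rj)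
    (hrem : ∀ l ∈ s.remaining, l ≠ i → l ≠ j → (∀ g ∈ Y i, v l (Y i \ {g}) ≤ v l (s.bundle l)) ∧
      ∀ g ∈ Y j, v l (Y j \ {g}) ≤ v l (s.bundle l))
    (hleft : s.remaining = {i, j} →
      ∀ g, g ∈ s.pool ∨ g ∈ s.bundle i ∨ g ∈ s.bundle j → g ∈ Y i ∨ g ∈ Y j) :
    RunInvariant v (s.finalize {i, j} Y) := by
  have hnotY : ∀ l ∈ s.remaining, l ≠ i → l ≠ j → ∀ g ∈ s.bundle l, g ∉ Y i ∧ g ∉ Y j := by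
    intro l _ hli hlj g hg
    rw [← not_or]
    intro hgY
    obtain ⟨p1, p2, -⟩ := h.isPartition
    rcases hsub g hgY with h | h | h
    · exact Finset.disjoint_left.1 (p2 l) hg h
    · exact Finset.disjoint_left.1 (p1 l i hli) hg h
    · exact Finset.disjoint_left.1 (p1 l j hlj) hg h
  have hmem : ∀ g ∈ (s.remaining \ {i, j}).biUnion s.bundle ∪ (s.finalize {i, j} Y).pool,
      g ∉ Y i ∧ g ∉ Y j ∧ ((g ∈ s.pool ∨ g ∈ s.bundle i ∨ g ∈ s.bundle j) ∨
      (∃ l ∈ s.remaining, l ≠ i ∧ l ≠ j ∧ g ∈ s.bundle l)) := by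
    intro g hg
    rw [Finset.mem_union] at hg
    rcases hg with hg | hg
    · obtain ⟨l, hl, hg⟩ := Finset.mem_biUnion.1 hg
      simp only [Finset.mem_sdiff, Finset.mem_insert, Finset.mem_singleton, not_or] at hl
      have := hnotY l hl.1 hl.2.1 hl.2.2 g hg
      exact ⟨this.1, this.2, Or.inr ⟨l, hl.1, hl.2.1, hl.2.2, hg⟩⟩
    · have := AlgState.mem_finalize_pool.1 hg
      simp only [Finset.mem_insert, Finset.mem_singleton, forall_eq_or_imp, forall_eq,
        exists_eq_or_imp, exists_eq_left] at this
      exact ⟨this.2.1, this.2.2, Or.inl this.1⟩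
  refine h.finalize hv (Finset.insert_subset hi (Finset.singleton_subset_iff.2 hj)) ⟨i, by simp⟩
    ?_ ?_ ?_ ?_ ?_ ?_ fun hrF => Or.inl (Finset.eq_empty_of_forall_notMem fun g hg => ?_)
  on_goal 7 =>
    have := AlgState.mem_finalize_pool.1 hg
    simp only [Finset.mem_insert, Finset.mem_singleton, forall_eq_or_imp, forall_eq,
        exists_eq_or_imp, exists_eq_left] at this
    exact (hleft hrF g this.1).elim this.2.1 this.2.2
  all_goals
    simp only [Finset.mem_insert, Finset.mem_singleton, forall_eq_or_imp, forall_eq,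
        exists_eq_or_imp, exists_eq_left]
  · exact ⟨⟨fun h => absurd rfl h, fun _ => hd⟩, fun _ => hd.symm, fun h => absurd rfl h⟩
  · exact ⟨fun g hg => hsub g (Or.inl hg), fun g hg => hsub g (Or.inr hg)⟩
  · exact ⟨hvali, hvalj⟩
  · exact ⟨⟨fun h => absurd rfl h, fun _ => hefxi⟩, fun _ => hefxj, fun h => absurd rfl h⟩
  · exact ⟨le_trans ((hv i).le_of_relevant fun g hg => hRi' g (hmem g hg).1 (hmem g hg).2.1
      (hmem g hg).2.2) hRi, le_trans ((hv j).le_of_relevant fun g hg => hRj' g (hmem g hg).1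
      (hmem g hg).2.1 (hmem g hg).2.2) hRj⟩
  · intro l hl hlF
    rw [not_or] at hlF
    exact hrem l hl hlF.1 hlF.2

/-- Nothing is left and nobody else remains, so all conditions on leftovers and outsiders are
vacuous. -/
theorem Rule3Two.runInvariant (hv : ∀ i, IsAdditiveValuation (v i)) (h : RunInvariant v s)
    {i j : N} (hEij : s.Edge v 0 i j) (hcard : s.remaining.card = 2)
    (hst : Rule3Two v s t i j) : RunInvariant v t := by
  have hi := hEij.1
  have hj := hEij.2.1
  have hij : i ≠ j := hEij.2.2.1
  obtain ⟨Y, hd, hU, he1, he2, hvi, hvj, rfl⟩ := hst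
  have hU' : ∀ g, (g ∈ Y i ∨ g ∈ Y j) ↔ (g ∈ s.bundle i ∨ g ∈ s.bundle j) ∨ g ∈ s.pool := by
    intro g
    rw [← Finset.mem_union, hU, Finset.mem_union, Finset.mem_union]
  have hrem : s.remaining = {i, j} := by
    refine (Finset.eq_of_subset_of_card_le
      (Finset.insert_subset hi (Finset.singleton_subset_iff.2 hj)) ?_).symm
    rw [hcard, Finset.card_pair hij]
  have hnol : ∀ l ∈ s.remaining, l ≠ i → l ≠ j → False := by
    intro l hl hli hlj
    rw [hrem] at hl
    simp [hli, hlj] at hl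
  rw [not_stronglyEnvies, one_mul] at he1 he2
  have hnone : ∀ k g, g ∉ Y i → g ∉ Y j → (g ∈ s.pool ∨ g ∈ s.bundle i ∨ g ∈ s.bundle j) ∨
    (∃ l ∈ s.remaining, l ≠ i ∧ l ≠ j ∧ g ∈ s.bundle l) → Relevant v k g → g ∈ (∅ : Finset M) := by
    rintro k g hgi hgj (hg | ⟨l, hl, hli, hlj, -⟩)
    · have := hU' g
      tauto
    · exact (hnol l hl hli hlj).elim
  refine h.finalize_pair hv hi hj hd (fun g hg => by have := (hU' g).1 hg; tauto)
    (le_sqrt_two_mul ((hv i).nonneg _) hvi) (le_sqrt_two_mul ((hv j).nonneg _) hvj)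
    (fun g hg => le_sqrt_two_mul ((hv i).nonneg _) (he1 g hg))
    (fun g hg => le_sqrt_two_mul ((hv j).nonneg _) (he2 g hg))
    (Ri := ∅) (Rj := ∅) ?_ ?_ (hnone i) (hnone j)
    (fun l hl hli hlj => (hnol l hl hli hlj).elim) (fun _ g hg => (hU' g).2 (by tauto))
  · rw [(hv i).empty]
    exact mul_nonneg (Real.sqrt_nonneg _) ((hv i).nonneg _)
  · rw [(hv j).empty]
    exact mul_nonneg (Real.sqrt_nonneg _) ((hv j).nonneg _)

/-- After the possible swap neither agent has lost, `j` does not envy `i`, and `i` does not strongly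
envy `j`. To `j`, the set `A` is worth no more than `Z i`; to `i`, the set `C` is worth no more than
her old bundle, by the failure of Rule 1. As `i` and `j` are each other's only successors, the other
remaining bundles are worthless to both. No factor `√2` is lost. -/
theorem Rule3Many.runInvariant (hv : ∀ i, IsAdditiveValuation (v i)) (hb : IsBounded v 2 ⊤)
    (h : RunInvariant v s) (h1 : ¬ Rule1Applicable v s) (h2 : ¬ Rule2Applicable v s) {i j : N}
    (hEij : s.Edge v 0 i j) (hEji : s.Edge v 0 j i) (hcard : s.remaining.card ≠ 2)
    (hst : Rule3Many v s t i j) : RunInvariant v t := by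
  have hi := hEij.1
  have hj := hEij.2.1
  have hij : i ≠ j := hEij.2.2.1
  obtain ⟨Z, hZ, hji, A, B, C, hA, hB, hC, Y, hY, rfl⟩ := hst
  obtain ⟨p1, p2, -⟩ := h.isPartition
  have hefx := isApproxEFXOn_one.1 h.invariant.remaining_efx
  rw [EnviesSet, not_lt] at hji
  obtain ⟨hZmem, hZd, hZi, hZj, hZefx⟩ : (∀ g, (g ∈ Z i ∨ g ∈ Z j) ↔
      (g ∈ s.bundle i ∨ g ∈ s.bundle j)) ∧ Disjoint (Z i) (Z j) ∧
      v i (s.bundle i) ≤ v i (Z i) ∧ v j (s.bundle j) ≤ v j (Z j) ∧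
      (∀ g ∈ Z j, v i (Z j \ {g}) ≤ v i (Z i)) := by
    split_ifs at hZ with henv
    · have hZi : Z i = s.bundle j := by simp [hZ]
      have hZj : Z j = s.bundle i := by simp [hZ]
      rw [hZi, hZj]
      exact ⟨fun g => or_comm, p1 j i hij.symm, henv.1.le, henv.2.le,
        fun g _ => ((hv i).sdiff_singleton_le _ g).trans henv.1.le⟩
    · subst hZ
      exact ⟨fun g => Iff.rfl, p1 i j hij, le_rfl, le_rfl, hefx i hi j hj hij⟩
  have hZp : ∀ g, g ∈ Z i ∨ g ∈ Z j → g ∉ s.pool := by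
    intro g hg hgp
    rcases (hZmem g).1 hg with hg | hg
    · exact Finset.disjoint_left.1 (p2 i) hg hgp
    · exact Finset.disjoint_left.1 (p2 j) hg hgp
  have hZd' : ∀ g, g ∈ Z i → g ∉ Z j := fun _ hg => Finset.disjoint_left.1 hZd hg
  have hZl : ∀ l, l ≠ i → l ≠ j → ∀ g, g ∈ Z i ∨ g ∈ Z j → ¬ Relevant v l g := by
    intro l hli hlj g hg hr
    rcases (hZmem g).1 hg with hg | hg
    · rcases h.eq_or_eq_of_edge hv hb hEji hg hr with h | h
      exacts [hlj h, hli h]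
    · rcases h.eq_or_eq_of_edge hv hb hEij hg hr with h | h
      exacts [hli h, hlj h]
  have hirr : ∀ g, (∃ l ∈ s.remaining, l ≠ i ∧ l ≠ j ∧ g ∈ s.bundle l) →
      ¬ Relevant v i g ∧ ¬ Relevant v j g := by
    rintro g ⟨l, hl, hli, hlj, hg⟩
    exact ⟨h.not_relevant hv hb h2 hEij hl hli hlj hg, h.not_relevant hv hb h2 hEji hl hlj hli hg⟩
  have hAmem : ∀ g, g ∈ A ↔ g ∈ Z i ∨ (g ∈ s.pool ∧ Relevant v i g ∧ ¬ Relevant v j g) := by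
    intro g
    rw [hA, Finset.mem_union, Finset.mem_sdiff, mem_relTo, mem_relToBoth hij]
    tauto
  have hBmem : ∀ g, g ∈ B ↔ g ∈ Z j := fun g => by rw [hB]
  have hCmem : ∀ g, g ∈ C ↔ g ∈ s.pool ∧ Relevant v j g := fun g => by rw [hC, mem_relTo]
  have hjA : v j A ≤ v j (Z i) := (hv j).le_of_relevant fun g hg hr => by
    have : Relevant v j g := hr
    have := (hAmem g).1 hg
    tauto
  have hiA : v i (Z i) ≤ v i A := (hv i).mono _ _ fun g hg => (hAmem g).2 (Or.inl hg)
  have hPij := value_pool_le h1 hi hj hij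
  have hiC : v i C ≤ v i (s.bundle i) := le_trans ((hv i).le_of_relevant fun g hg hr =>
    (mem_relToBoth hij).2 ⟨((hCmem g).1 hg).1, hr, ((hCmem g).1 hg).2⟩) hPij
  have hlA : ∀ l ∈ s.remaining, l ≠ i → l ≠ j → ∀ g ∈ A, v l (A \ {g}) ≤ v l (s.bundle l) :=
    fun l hl hli hlj g _ => value_sdiff_le_of_subset_pool hv h1 hl hi hli (fun x hx hr => by
      have := hZl l hli hlj x
      have := (hAmem x).1 hx
      tauto) g
  have hlB : ∀ l ∈ s.remaining, l ≠ i → l ≠ j → ∀ g ∈ B, v l (B \ {g}) ≤ v l (s.bundle l) :=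
    fun l hl hli hlj g _ => value_sdiff_le_of_subset_pool hv h1 hl hi hli (fun x hx hr => by
      have := hZl l hli hlj x
      have := (hBmem x).1 hx
      tauto) g
  have hlC : ∀ l ∈ s.remaining, l ≠ i → l ≠ j → ∀ g ∈ C, v l (C \ {g}) ≤ v l (s.bundle l) :=
    fun l hl _ hlj g _ => value_sdiff_le_of_subset_pool hv h1 hl hj hlj (fun x hx _ =>
      (hCmem x).1 hx) g
  have hleft : s.remaining = {i, j} →
      ∀ g, g ∈ s.pool ∨ g ∈ s.bundle i ∨ g ∈ s.bundle j → g ∈ Y i ∨ g ∈ Y j := fun hr =>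
    absurd (hr ▸ Finset.card_pair hij) hcard
  have key : ∀ {a b : ℝ} (k : N) (S : Finset M), b = v k S → a ≤ b → a ≤ √2 * b :=
    fun k S hb hab => le_sqrt_two_mul (hb ▸ (hv k).nonneg S) hab
  have ni := (hv i).nonneg (Y i)
  have nj := (hv j).nonneg (Y j)
  have sd : ∀ k (S : Finset M) (g : M), v k (S \ {g}) ≤ v k S :=
    fun k S g => (hv k).sdiff_singleton_le S g
  -- In the three outcomes the goods left that matter to `i` lie in the shared pool goods, `B` and
  -- `A`; those that matter to `j` lie in `C`, `B` and `Z i`.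
  rcases hY with ⟨hCB, hYj, hYi⟩ | ⟨hBC, hBA, hYj, hYi⟩ | ⟨hBC, hAB, hYj, hYi⟩
  · rw [hYi] at ni
    rw [hYj] at nj
    refine h.finalize_pair hv hi hj (Ri := relToBoth v s.pool i j) (Rj := C)
      ?_ ?_ ?_ ?_ ?_ ?_ ?_ ?_ ?_ ?_ ?_ hleft <;> (try rw [hYi]) <;> (try rw [hYj])
    · rw [Finset.disjoint_left]
      intro g hg
      have a1 := (hAmem g).1 hg; have a2 := hBmem g; have a3 := hZp g; have a4 := hZd' g
      grind only
    · intro g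
      have a1 := hAmem g; have a2 := hBmem g; have a3 := hZmem g
      grind only
    · exact le_sqrt_two_mul ni (hZi.trans hiA)
    · exact le_sqrt_two_mul nj (hB ▸ hZj)
    · exact fun g hg => le_sqrt_two_mul ni ((hB ▸ hZefx g (hB ▸ hg)).trans hiA)
    · exact fun g hg => le_sqrt_two_mul nj ((sd j A g).trans (hjA.trans (hB ▸ hji)))
    · exact le_sqrt_two_mul ni (hPij.trans (hZi.trans hiA))
    · exact le_sqrt_two_mul nj hCB
    · rintro g hg₁ hg₂ (hg | hg) hr
      swap; · exact absurd hr (hirr g hg).1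
      rw [mem_relToBoth hij]
      have a1 := hAmem g; have a2 := hBmem g; have a3 := hZmem g
      grind only
    · rintro g hg₁ hg₂ (hg | hg) hr
      swap; · exact absurd hr (hirr g hg).2
      have a1 := hAmem g; have a2 := hBmem g; have a3 := hCmem g; have a4 := hZmem g
      grind only
    · exact fun l hl hli hlj => ⟨hlA l hl hli hlj, hlB l hl hli hlj⟩
  · rw [hYi] at ni
    rw [hYj] at nj
    refine h.finalize_pair hv hi hj (Ri := B) (Rj := B)
      ?_ ?_ ?_ ?_ ?_ ?_ ?_ ?_ ?_ ?_ ?_ hleft <;> (try rw [hYi]) <;> (try rw [hYj])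
    · rw [Finset.disjoint_left]
      intro g hg
      have a1 := (hAmem g).1 hg; have a2 := hCmem g; have a3 := hZp g
      grind only
    · intro g
      have a1 := hAmem g; have a2 := hCmem g; have a3 := hZmem g
      grind only
    · exact le_sqrt_two_mul ni (hZi.trans hiA)
    · exact le_sqrt_two_mul nj ((hB ▸ hZj).trans hBC)
    · exact fun g hg => le_sqrt_two_mul ni ((sd i C g).trans (hiC.trans (hZi.trans hiA)))
    · exact fun g hg => le_sqrt_two_mul nj ((sd j A g).trans (hjA.trans ((hB ▸ hji).trans hBC)))
    · exact le_sqrt_two_mul ni hBA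
    · exact le_sqrt_two_mul nj hBC
    · rintro g hg₁ hg₂ (hg | hg) hr
      swap; · exact absurd hr (hirr g hg).1
      have a1 := hAmem g; have a2 := hBmem g; have a3 := hCmem g; have a4 := hZmem g
      grind only
    · rintro g hg₁ hg₂ (hg | hg) hr
      swap; · exact absurd hr (hirr g hg).2
      have a1 := hAmem g; have a2 := hBmem g; have a3 := hCmem g; have a4 := hZmem g
      grind only
    · exact fun l hl hli hlj => ⟨hlA l hl hli hlj, hlC l hl hli hlj⟩
  · rw [hYi] at ni
    rw [hYj] at nj
    refine h.finalize_pair hv hi hj (Ri := A) (Rj := Z i)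
      ?_ ?_ ?_ ?_ ?_ ?_ ?_ ?_ ?_ ?_ ?_ hleft <;> (try rw [hYi]) <;> (try rw [hYj])
    · rw [Finset.disjoint_left]
      intro g hg
      have a1 := (hBmem g).1 hg; have a2 := hCmem g; have a3 := hZp g
      grind only
    · intro g
      have a1 := hBmem g; have a2 := hCmem g; have a3 := hZmem g
      grind only
    · exact le_sqrt_two_mul ni (hZi.trans (hiA.trans hAB))
    · exact le_sqrt_two_mul nj ((hB ▸ hZj).trans hBC)
    · exact fun g hg => le_sqrt_two_mul ni
        ((sd i C g).trans (hiC.trans (hZi.trans (hiA.trans hAB))))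
    · exact fun g hg => le_sqrt_two_mul nj ((sd j B g).trans hBC)
    · exact le_sqrt_two_mul ni hAB
    · exact le_sqrt_two_mul nj ((hB ▸ hji).trans hBC)
    · rintro g hg₁ hg₂ (hg | hg) hr
      swap; · exact absurd hr (hirr g hg).1
      have a1 := hAmem g; have a2 := hBmem g; have a3 := hCmem g; have a4 := hZmem g
      grind only
    · rintro g hg₁ hg₂ (hg | hg) hr
      swap; · exact absurd hr (hirr g hg).2
      have a1 := hAmem g; have a2 := hBmem g; have a3 := hCmem g; have a4 := hZmem g
      grind only
    · exact fun l hl hli hlj => ⟨hlB l hl hli hlj, hlC l hl hli hlj⟩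

theorem Rule3.runInvariant (hv : ∀ i, IsAdditiveValuation (v i)) (hb : IsBounded v 2 ⊤)
    (h : RunInvariant v s) (h1 : ¬ Rule1Applicable v s) (h2 : ¬ Rule2Applicable v s)
    (hst : Rule3 v s t) : RunInvariant v t := by
  obtain ⟨i, j, hEij, hEji, ⟨hcard, hst⟩ | ⟨hcard, hst⟩⟩ := hst
  · exact hst.runInvariant hv h hEij hcard
  · exact hst.runInvariant hv hb h h1 h2 hEij hEji hcard

/-- Besides her own bundle, `j` values only that of `k` among the remaining ones. If she keeps her
bundle, that of `k` and the pool add up to at most `√2` times hers. If she takes the pool goods, she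
loses a factor below `√2`, and so does `i` in moving along the heavy edge; what is left for them is
the old bundle of `i` and the bundle of `k`. -/
theorem Rule5.runInvariant (hv : ∀ i, IsAdditiveValuation (v i)) (hb : IsBounded v 2 ⊤)
    (h : RunInvariant v s) (h1 : ¬ Rule1Applicable v s) (h2 : ¬ Rule2Applicable v s)
    (h3 : ¬ Rule3Applicable v s) (hst : Rule5 v s t) : RunInvariant v t := by
  obtain ⟨σ, hσ, -, i, j, k, hσi, hji, hkj, hheavy, hlight, hst⟩ := hst
  have hEij : s.Edge v 0 i j := hji ▸ hσ.2 i hσi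
  have hEjk : s.Edge v 0 j k := hkj ▸ hσ.2 j (by rw [hji]; exact fun h => hσi (σ.injective h))
  have hi := hEij.1
  have hj := hEij.2.1
  have hk := hEjk.2.1
  have hij : i ≠ j := hEij.2.2.1
  have hjk : j ≠ k := hEjk.2.2.1
  -- Without 2-cycles `k` is a third remaining agent, so this pair is never the last to be
  -- finalized.
  have hki : k ≠ i := by
    rintro rfl
    exact h3 ⟨_, _, hEij, hEjk⟩
  have hjk' := AlgState.sqrt_two_mul_le_of_not_heavy hEjk hlight
  have h0 : 0 < √2 := by positivity
  have hsq : √2 * √2 = 2 := Real.mul_self_sqrt (by norm_num)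
  obtain ⟨p1, p2, -⟩ := h.isPartition
  have hirri : ∀ l ∈ s.remaining, l ≠ i → l ≠ j → ∀ g ∈ s.bundle l, ¬ Relevant v i g :=
    fun l hl hli hlj g hg => h.not_relevant hv hb h2 hEij hl hli hlj hg
  have hirrj : ∀ l ∈ s.remaining, l ≠ j → l ≠ k → ∀ g ∈ s.bundle l, ¬ Relevant v j g :=
    fun l hl hlj hlk g hg => h.not_relevant hv hb h2 hEjk hl hlj hlk hg
  rcases hst with ⟨hP, rfl⟩ | ⟨hP, Y, hYj, hYi, rfl⟩
  · refine h.finalize hv (Finset.singleton_subset_iff.2 hj) (Finset.singleton_nonempty j)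
      ?_ ?_ ?_ ?_ ?_ ?_ ?_ <;> simp only [Finset.mem_singleton, forall_eq, exists_eq_left]
    · exact fun h => absurd rfl h
    · exact fun g hg => Or.inr hg
    · exact le_sqrt_two_mul ((hv j).nonneg _) le_rfl
    · exact fun h => absurd rfl h
    · refine le_trans ((hv j).le_of_relevant (T := s.bundle k ∪ relTo v s.pool j) ?_)
        (((hv j).union_le _ _).trans ?_)
      · intro g hg hr
        rw [Finset.mem_union] at hg ⊢
        rcases hg with hg | hg
        · obtain ⟨l, hl, hg⟩ := Finset.mem_biUnion.1 hg
          rw [Finset.mem_sdiff, Finset.mem_singleton] at hl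
          by_cases hlk : l = k
          · exact Or.inl (hlk ▸ hg)
          · exact absurd hr (hirrj l hl.1 hl.2 hlk g hg)
        · have := AlgState.mem_finalize_pool.1 hg
          simp only [Finset.mem_singleton, forall_eq, exists_eq_left] at this
          exact Or.inr (mem_relTo.2 ⟨by tauto, hr⟩)
      -- Multiplied by `√2`, the bundle of `k` and the pool are each at most the bundle of `j`, and
      -- `2 = √2 * √2`.
      · rw [le_div_iff₀ h0] at hP
        refine le_of_mul_le_mul_left ?_ h0
        rw [← mul_assoc, hsq]
        linarith
    · exact fun l hl hlj => isApproxEFXOn_one.1 h.invariant.remaining_efx l hl j hj hlj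
    · exact fun _ => Or.inr fun h => absurd rfl h
  · rw [le_div_iff₀ h0, mul_comm, not_le] at hP
    have hYim : ∀ g, g ∈ Y i ↔
        g ∈ s.bundle j ∨ (g ∈ s.pool ∧ Relevant v i g ∧ ¬ Relevant v j g) := by
      intro g
      rw [hYi, Finset.mem_union, Finset.mem_sdiff, mem_relTo, mem_relToBoth hij]
      tauto
    have hYjm : ∀ g, g ∈ Y j ↔ g ∈ s.pool ∧ Relevant v j g := fun g => by rw [hYj, mem_relTo]
    have hXY : v i (s.bundle j) ≤ v i (Y i) :=
      (hv i).mono _ _ fun g hg => (hYim g).2 (Or.inl hg)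
    have hvali : v i (s.bundle i) ≤ √2 * v i (Y i) :=
      hheavy.value_lt.le.trans (mul_le_mul_of_nonneg_left hXY h0.le)
    have hvalj : v j (s.bundle j) ≤ √2 * v j (Y j) := hYj ▸ hP.le
    refine h.finalize_pair hv hi hj (Ri := s.bundle i) (Rj := s.bundle k)
      ?_ ?_ hvali hvalj ?_ ?_ hvali ?_ ?_ ?_ ?_ ?_
    · rw [Finset.disjoint_left]
      intro g hg
      have := (hYim g).1 hg; have := hYjm g
      have : g ∈ s.bundle j → g ∉ s.pool :=
        fun hg => Finset.disjoint_left.1 (p2 j) hg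
      tauto
    · intro g
      have := hYim g; have := hYjm g
      tauto
    · intro g _
      refine le_trans ?_ ((value_pool_le h1 hi hj hij).trans hvali)
      refine (hv i).le_of_relevant fun x hx hr => (mem_relToBoth hij).2 ?_
      have := (hYjm x).1 (Finset.sdiff_subset hx)
      exact ⟨this.1, hr, this.2⟩
    · intro g _
      refine le_trans ((hv j).le_of_relevant fun x hx hr => ?_) hvalj
      have : Relevant v j x := hr
      have := (hYim x).1 (Finset.sdiff_subset hx)
      tauto
    · refine le_trans ?_ hvalj
      refine le_trans ?_ hjk'
      exact le_sqrt_two_mul ((hv j).nonneg _) le_rfl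
    · rintro g hgi hgj (hg | ⟨l, hl, hli, hlj, hg⟩) hr
      · have := hYim g; have := hYjm g
        tauto
      · exact absurd hr (hirri l hl hli hlj g hg)
    · rintro g hgi hgj (hg | ⟨l, hl, hli, hlj, hg⟩) hr
      · have := hYim g; have := hYjm g; have := hirrj i hi hij hki.symm g
        tauto
      · by_cases hlk : l = k
        · exact hlk ▸ hg
        · exact absurd hr (hirrj l hl hlj hlk g hg)
    · intro l hl hli hlj
      refine ⟨fun g _ => value_sdiff_le_of_subset_pool hv h1 hl hi hli (fun x hx hr => ?_) g,
        fun g _ => value_sdiff_le_of_subset_pool hv h1 hl hj hlj (fun x hx _ => (hYjm x).1 hx) g⟩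
      rcases (hYim x).1 hx with hx | hx
      · rcases h.eq_or_eq_of_edge hv hb hEij hx hr with h | h
        exacts [absurd h hli, absurd h hlj]
      · exact ⟨hx.1, hx.2.1⟩
    · intro hrem
      rw [hrem] at hk
      simp [hki, hjk.symm] at hk

end CycleRules

/-! ### Rule 4, and the invariant along a run -/

section HomogeneousCycle

variable {N M : Type*} [Fintype N] [DecidableEq N] {v : N → Finset M → ℝ} {s t : AlgState N M}

theorem AlgState.IsEnvyCycle.edge {σ : Equiv.Perm N} (hσ : s.IsEnvyCycle v σ) {i : N}
    (hi : i ∈ σ.support) : s.Edge v 0 i (σ i) :=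
  hσ.2 i (Equiv.Perm.mem_support.1 hi)

theorem AlgState.IsEnvyCycle.apply_apply_ne {σ : Equiv.Perm N} (hσ : s.IsEnvyCycle v σ)
    (h3 : ¬ Rule3Applicable v s) {i : N} (hi : i ∈ σ.support) : σ (σ i) ≠ i := by
  intro h
  have := hσ.edge (Equiv.Perm.apply_mem_support.2 hi)
  rw [h] at this
  exact h3 ⟨i, σ i, hσ.edge hi, this⟩

variable [Fintype M] [DecidableEq M]

/-- The properties of the bundles `Z` and the cycle `τ` that arise from a homogeneous cycle `σ`. -/
theorem AlgState.IsEnvyCycle.homogeneous (hv : ∀ i, IsAdditiveValuation (v i))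
    (hb : IsBounded v 2 ⊤) (h : RunInvariant v s) {σ τ : Equiv.Perm N} {Z : N → Finset M}
    (hσ : s.IsEnvyCycle v σ)
    (hτZ : (s.AllHeavy v σ ∧ τ = σ⁻¹ ∧ Z = s.bundle ∘ σ) ∨
      (s.AllLight v σ ∧ τ = σ ∧ Z = s.bundle)) :
    (∀ k ∈ σ.support, ∃ p ∈ σ.support, p ≠ k ∧ τ p = k ∧
      ∀ g ∈ Z k, ∀ l, Relevant v l g → l = p ∨ l = k) ∧
    (∀ i ∈ σ.support, v i (Z (τ i)) ≤ √2 * v i (Z i)) ∧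
    (∀ i ∈ σ.support, v i (s.bundle i) ≤ √2 * v i (Z i)) ∧
    (∀ i ∈ σ.support, ∃ k ∈ σ.support, Z i = s.bundle k) ∧
    (∀ i ∈ σ.support, ∃ k ∈ σ.support, s.bundle i = Z k) ∧
    (∀ i k, i ≠ k → Disjoint (Z i) (Z k)) := by
  have happ : ∀ {i}, i ∈ σ.support → σ i ∈ σ.support := fun hi =>
    Equiv.Perm.apply_mem_support.2 hi
  have hinv : ∀ {i}, i ∈ σ.support → σ⁻¹ i ∈ σ.support := fun hi => by
    rw [← Equiv.Perm.apply_mem_support]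
    simpa using hi
  have hne : ∀ {i}, i ∈ σ.support → σ i ≠ i := fun hi => Equiv.Perm.mem_support.1 hi
  have p1 := h.isPartition.1
  rcases hτZ with ⟨hH, rfl, rfl⟩ | ⟨hL, rfl, rfl⟩
  -- After the rotation `Z (τ i)` is the old bundle of `i`, so heaviness of the old edge bounds both
  -- the loss of `i` and her envy along the reversed edge.
  · have hlt : ∀ i ∈ σ.support, v i (s.bundle i) ≤ √2 * v i (s.bundle (σ i)) := fun i hi =>
      (hH i (hne hi)).value_lt.le
    refine ⟨fun k hk => ⟨σ k, happ hk, hne hk, by simp, fun g hg l hl => ?_⟩, fun i hi => ?_,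
      hlt, fun i hi => ⟨σ i, happ hi, rfl⟩, fun i hi => ⟨σ⁻¹ i, hinv hi, by simp⟩,
      fun i k hik => p1 _ _ (σ.injective.ne hik)⟩
    · exact (h.eq_or_eq_of_edge hv hb (hσ.edge hk) hg hl).symm
    · simpa using hlt i hi
  · refine ⟨fun k hk => ⟨τ⁻¹ k, hinv hk, fun h => ?_, by simp, fun g hg l hl => ?_⟩, fun i hi => ?_,
      fun i _ => le_sqrt_two_mul ((hv i).nonneg _) le_rfl, fun i hi => ⟨i, hi, rfl⟩,
      fun i hi => ⟨i, hi, rfl⟩, p1⟩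
    · exact hne hk (by rw [Equiv.Perm.inv_eq_iff_eq] at h; exact h.symm)
    · have := hσ.edge (hinv hk)
      rw [show τ (τ⁻¹ k) = k by simp] at this
      exact h.eq_or_eq_of_edge hv hb this hg hl
    · have h1 := AlgState.sqrt_two_mul_le_of_not_heavy (hσ.edge hi) (hL i (hne hi))
      exact (le_sqrt_two_mul ((hv i).nonneg _) le_rfl).trans
        (h1.trans (le_sqrt_two_mul ((hv i).nonneg _) le_rfl))

/-- The pool goods shared by `i` and `τ i` go to `i`, so she values only `Z (τ i)` in the bundle of
`τ i`. In the bundle of any other `k` on the cycle she values only shared pool goods, which the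
failure of Rule 1 bounds. Envy is thus within `√2` even before a good is removed, and nothing that
matters to the cycle is left. -/
theorem Rule4.runInvariant (hv : ∀ i, IsAdditiveValuation (v i)) (hb : IsBounded v 2 ⊤)
    (h : RunInvariant v s) (h1 : ¬ Rule1Applicable v s) (h2 : ¬ Rule2Applicable v s)
    (hst : Rule4 v s t) : RunInvariant v t := by
  obtain ⟨σ, hσ, τ, Z, hτZ, r, hr, hrτ, rfl⟩ := hst
  obtain ⟨hpred, hZτ, hval, hZX, hXZ, hZd⟩ := hσ.homogeneous hv hb h hτZ
  obtain ⟨p1, p2, -⟩ := h.isPartition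
  set F := σ.support with hF
  set Y : N → Finset M := fun i => Z i ∪ {g ∈ relTo v s.pool i | r g = i} with hY
  have hYm : ∀ i g, g ∈ Y i ↔ g ∈ Z i ∨ (g ∈ s.pool ∧ Relevant v i g ∧ r g = i) := by
    intro i g
    simp only [hY, Finset.mem_union, Finset.mem_filter, mem_relTo, and_assoc]
  have hZp : ∀ i ∈ F, ∀ g ∈ Z i, g ∉ s.pool := by
    intro i hi g hg
    obtain ⟨k, -, hk⟩ := hZX i hi
    rw [hk] at hg
    exact Finset.disjoint_left.1 (p2 k) hg
  have hFr : ∀ i ∈ F, i ∈ s.remaining := fun i hi => (hσ.edge hi).1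
  have h0 : 0 ≤ √2 := Real.sqrt_nonneg _
  have hZY : ∀ i, √2 * v i (Z i) ≤ √2 * v i (Y i) := fun i =>
    mul_le_mul_of_nonneg_left ((hv i).mono _ _ Finset.subset_union_left) h0
  have henvy : ∀ i ∈ F, ∀ k ∈ F, i ≠ k → v i (Y k) ≤ √2 * v i (Y i) := by
    intro i hi k hk hik
    refine le_trans ?_ (hZY i)
    by_cases hτ : τ i = k
    · subst hτ
      refine le_trans ((hv i).le_of_relevant fun g hg hgi => ?_) (hZτ i hi)
      rcases (hYm _ g).1 hg with hg | ⟨hgp, hgk, hgr⟩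
      · exact hg
      · exact absurd ((hrτ i hi g ((mem_relToBoth hik).2 ⟨hgp, hgi, hgk⟩)).symm.trans hgr) hik
    · refine le_trans ((hv i).le_of_relevant fun g hg hgi => ?_)
        ((value_pool_le h1 (hFr i hi) (hFr k hk) hik).trans (hval i hi))
      rcases (hYm _ g).1 hg with hg | ⟨hgp, hgk, hgr⟩
      · obtain ⟨p, -, -, hpk, hp⟩ := hpred k hk
        rcases hp g hg i hgi with rfl | h
        exacts [absurd hpk hτ, absurd h hik]
      · exact (mem_relToBoth hik).2 ⟨hgp, hgi, hgk⟩
  have hpool : ∀ i ∈ F, ∀ g ∈ (s.finalize F Y).pool, ¬ Relevant v i g := by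
    intro i hi g hg hgi
    obtain ⟨hg | ⟨k, hk, hg⟩, hno⟩ := AlgState.mem_finalize_pool.1 hg
    · obtain ⟨hrF, hrg⟩ := hr i hi g (mem_relTo.2 ⟨hg, hgi⟩)
      exact hno (r g) hrF ((hYm _ g).2 (Or.inr ⟨hg, hrg, rfl⟩))
    · obtain ⟨l, hl, hlk⟩ := hXZ k hk
      exact hno l hl ((hYm _ g).2 (Or.inl (hlk ▸ hg)))
  refine h.finalize hv hFr hσ.1.nonempty_support ?_ ?_ ?_ ?_ ?_ ?_ ?_
  · intro i hi k hk hik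
    rw [Finset.disjoint_left]
    intro g hgi hgk
    rcases (hYm _ g).1 hgi with hgi | ⟨hgp, -, hri⟩ <;>
      rcases (hYm _ g).1 hgk with hgk | ⟨hgp', -, hrk⟩
    · exact Finset.disjoint_left.1 (hZd i k hik) hgi hgk
    · exact hZp i hi g hgi hgp'
    · exact hZp k hk g hgk hgp
    · exact hik (hri.symm.trans hrk)
  · intro i hi g hg
    rcases (hYm _ g).1 hg with hg | ⟨hgp, -, -⟩
    · obtain ⟨k, hk, hki⟩ := hZX i hi
      exact Or.inr ⟨k, hk, hki ▸ hg⟩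
    · exact Or.inl hgp
  · exact fun i hi => (hval i hi).trans (hZY i)
  · exact fun i hi k hk hik g _ => ((hv i).sdiff_singleton_le _ g).trans (henvy i hi k hk hik)
  · intro i hi
    refine le_trans ((hv i).le_of_relevant (T := ∅) fun g hg hgi => ?_) ?_
    · exfalso
      rcases Finset.mem_union.1 hg with hg | hg
      · obtain ⟨l, hl, hg⟩ := Finset.mem_biUnion.1 hg
        rw [Finset.mem_sdiff] at hl
        have hEi := hσ.edge hi
        refine h.not_relevant hv hb h2 hEi hl.1 ?_ ?_ hg hgi
        · rintro rfl
          exact hl.2 hi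
        · rintro rfl
          exact hl.2 (Equiv.Perm.apply_mem_support.2 hi)
      · exact hpool i hi g hg hgi
    · rw [(hv i).empty]
      exact mul_nonneg h0 ((hv i).nonneg _)
  · intro l hl hlF k hk g _
    have hlk : l ≠ k := by
      rintro rfl
      exact hlF hk
    refine value_sdiff_le_of_subset_pool hv h1 hl (hFr k hk) hlk (fun x hx hxl => ?_) g
    rcases (hYm _ x).1 hx with hx | ⟨hxp, hxk, -⟩
    · obtain ⟨p, hpF, -, -, hp⟩ := hpred k hk
      rcases hp x hx l hxl with rfl | h
      exacts [absurd hpF hlF, absurd h hlk]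
    · exact ⟨hxp, hxk⟩
  · intro _
    refine Or.inr fun i hi k hk hki => le_trans ((hv k).le_of_relevant fun g hg hgk => ?_)
      (henvy k hk i hi hki)
    exact (Finset.mem_union.1 hg).resolve_right fun hg => hpool k hk g hg hgk

theorem AlgStep.runInvariant (hv : ∀ i, IsAdditiveValuation (v i)) (hb : IsBounded v 2 ⊤)
    (h : RunInvariant v s) (hst : AlgStep v s t) : RunInvariant v t := by
  obtain ⟨k, -, hmin, hk⟩ := hst
  have hn : ∀ l : Fin 5, l < k → ¬ RuleApplicable v l s := hmin
  fin_cases k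
  · exact Rule1.runInvariant hv hb h hk
  · exact Rule2.runInvariant hv h (hn 0 (by decide)) hk
  · exact Rule3.runInvariant hv hb h (hn 0 (by decide)) (hn 1 (by decide)) hk
  · exact Rule4.runInvariant hv hb h (hn 0 (by decide)) (hn 1 (by decide)) hk
  · exact Rule5.runInvariant hv hb h (hn 0 (by decide)) (hn 1 (by decide)) (hn 2 (by decide)) hk

theorem RunInvariant.init [Nonempty N] {f : N → M} (hf : IsBasicFeasible v f)
    (hv : ∀ i, IsAdditiveValuation (v i)) : RunInvariant v (initState f) := by
  have hempty : ∀ i k g, g ∈ ({f k} : Finset M) → v i ({f k} \ {g}) = 0 := by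
    intro i k g hg
    rw [Finset.mem_singleton] at hg
    rw [hg, sdiff_self]
    exact (hv i).empty
  refine ⟨⟨fun i k hik => ?_, fun i => ?_, fun g => ?_⟩, ⟨?_, ?_, ?_, ?_, ?_⟩, ?_, ?_⟩
  · simpa [initState] using hf.1.ne hik
  · simp [initState]
  · by_cases hg : ∃ i, f i = g
    · obtain ⟨i, rfl⟩ := hg
      exact Or.inr ⟨i, by simp [initState]⟩
    · exact Or.inl (by simpa [initState] using hg)
  · exact fun i hi => absurd (Finset.mem_univ i) hi
  · exact fun i hi => absurd (Finset.mem_univ i) hi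
  · rw [isApproxEFXOn_one]
    intro i _ k _ _ g hg
    exact (hempty i k g hg).trans_le ((hv i).nonneg _)
  · exact fun i _ k hk => absurd (Finset.mem_univ k) hk
  · intro i _
    have hri : Relevant v i (f i) := (hf.2.2 i).ne'
    by_cases hk : ∃ k, k ≠ i ∧ Relevant v k (f i)
    · obtain ⟨k, hki, hk⟩ := hk
      exact ⟨k, Finset.singleton_subset_iff.2
        ((mem_relToBoth hki.symm).2 ⟨Finset.mem_univ _, hri, hk⟩)⟩
    · push Not at hk
      refine ⟨i, Finset.singleton_subset_iff.2 ?_⟩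
      simp only [relToBoth, Finset.mem_filter, Finset.mem_univ, true_and]
      exact ⟨hri, hri, fun _ k hkr => by_contra fun hne => hk k hne hkr⟩
  · exact fun ⟨i, hi⟩ => absurd (Finset.mem_univ i) hi
  · intro hemp
    obtain ⟨i⟩ := ‹Nonempty N›
    have : i ∈ (initState f).remaining := Finset.mem_univ i
    rw [hemp] at this
    simp at this

theorem AlgReachable.runInvariant [Nonempty N] {f : N → M} (hf : IsBasicFeasible v f)
    (hv : ∀ i, IsAdditiveValuation (v i)) (hb : IsBounded v 2 ⊤) (hs : AlgReachable v f s) :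
    RunInvariant v s := by
  induction hs with
  | refl => exact RunInvariant.init hf hv
  | tail _ hst ih => exact hst.runInvariant hv hb ih

end HomogeneousCycle

/-! ### Heavy and light edges on a heterogeneous cycle -/

section Heterogeneous

variable {N M : Type*} [Fintype N] {v : N → Finset M → ℝ} {s : AlgState N M}

/-- Otherwise heaviness would spread from one heavy edge along the powers of `σ` to the whole cycle.
-/
theorem AlgState.IsEnvyCycle.exists_heavy_light {σ : Equiv.Perm N} (hσ : s.IsEnvyCycle v σ)
    (hhet : ¬ (s.AllHeavy v σ ∨ s.AllLight v σ)) :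
    ∃ i, σ i ≠ i ∧ s.Heavy v i (σ i) ∧ ¬ s.Heavy v (σ i) (σ (σ i)) := by
  rw [not_or] at hhet
  obtain ⟨hH, hL⟩ := hhet
  simp only [AlgState.AllLight, not_forall, not_not] at hL
  obtain ⟨i, hi, hiH⟩ := hL
  by_contra! hall
  refine hH fun k hk => ?_
  have hpow : ∀ n : ℕ, σ ((σ ^ n) i) ≠ (σ ^ n) i ∧ s.Heavy v ((σ ^ n) i) (σ ((σ ^ n) i)) := by
    intro n
    induction n with
    | zero => exact ⟨hi, hiH⟩
    | succ n ih =>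
      rw [pow_succ', Equiv.Perm.mul_apply]
      exact ⟨σ.injective.ne ih.1, hall _ ih.1 ih.2⟩
  obtain ⟨n, rfl⟩ := hσ.1.exists_pow_eq hi hk
  exact (hpow n).2

end Heterogeneous

/-! ### Termination -/

section Termination

variable {N M : Type*} [Fintype N] [DecidableEq N] [DecidableEq M]
  {v : N → Finset M → ℝ} {s t : AlgState N M}

/-- The potential of a state, which decreases lexicographically. -/
noncomputable def potential (v : N → Finset M → ℝ) (s : AlgState N M) : ℕ ×ₗ ℝ :=
  toLex (s.remaining.card, -∑ i, v i (s.bundle i))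

theorem potential_finalize_lt {F : Finset N} {Y : N → Finset M} {i : N} (hi : i ∈ F)
    (hir : i ∈ s.remaining) : potential v (s.finalize F Y) < potential v s := by
  rw [potential, potential, Prod.Lex.toLex_lt_toLex]
  refine Or.inl (Finset.card_lt_card (Finset.ssubset_iff_of_subset Finset.sdiff_subset |>.2
    ⟨i, hir, ?_⟩))
  simp [hi]

theorem AlgStep.potential_lt (hst : AlgStep v s t) : potential v t < potential v s := by
  obtain ⟨k, -, -, hk⟩ := hst
  fin_cases k
  · obtain ⟨i, hi, j, hj, hij, -, S, hS, -, r, hr, henv, rfl⟩ := hk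
    rw [potential, potential, Prod.Lex.toLex_lt_toLex]
    refine Or.inr ⟨rfl, neg_lt_neg (Finset.sum_lt_sum (fun l _ => ?_) ⟨r, Finset.mem_univ r, ?_⟩)⟩
    · by_cases hl : l = r
      · subst hl
        simpa using le_of_lt henv
      · simp [hl]
    · simpa [EnviesSet] using henv
  · obtain ⟨i, hi, rfl⟩ := hk
    exact potential_finalize_lt (Finset.mem_singleton_self i) hi.1
  · obtain ⟨i, j, hij, -, ⟨-, hst⟩ | ⟨-, hst⟩⟩ := hk
    · obtain ⟨Y, -, -, -, -, -, -, rfl⟩ := hst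
      exact potential_finalize_lt (Finset.mem_insert_self i _) hij.1
    · obtain ⟨Z, -, -, A, B, C, -, -, -, Y, -, rfl⟩ := hst
      exact potential_finalize_lt (Finset.mem_insert_self i _) hij.1
  · obtain ⟨σ, hσ, τ, Z, -, r, -, -, rfl⟩ := hk
    obtain ⟨i, hi⟩ := hσ.1.nonempty_support
    exact potential_finalize_lt hi (hσ.edge hi).1
  · obtain ⟨σ, hσ, -, i, j, k, hi, hj, -, hheavy, -, ⟨-, rfl⟩ | ⟨-, Y, -, -, rfl⟩⟩ := hk
    · exact potential_finalize_lt (Finset.mem_singleton_self j) hheavy.2.1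
    · exact potential_finalize_lt (Finset.mem_insert_self i _) hheavy.1

instance AlgState.finite {N M : Type*} [Finite N] [Finite M] : Finite (AlgState N M) :=
  Finite.of_injective
    (fun s : AlgState N M => (s.remaining, s.bundle, s.pool, s.lastFinalized))
    (fun s t h => by
      cases s; cases t
      simp only [Prod.mk.injEq] at h
      obtain ⟨rfl, rfl, rfl, rfl⟩ := h
      rfl)

/-- The order on `ℕ ×ₗ ℝ` is not well-founded, so a decreasing potential alone does not suffice; it
makes all states of a run distinct, which contradicts their finite number. -/
theorem no_infinite_run [Finite M] (run : ℕ → AlgState N M) :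
    ¬ ∀ n, AlgStep v (run n) (run (n + 1)) := by
  intro hrun
  have hanti : StrictAnti fun n => potential v (run n) :=
    strictAnti_nat_of_succ_lt fun n => (hrun n).potential_lt
  exact not_injective_infinite_finite run
    (Function.Injective.of_comp (f := potential v) hanti.injective)

end Termination

/-! ### Every applicable rule can be carried out -/

section Progress

variable {N M : Type*} [DecidableEq N] [DecidableEq M] {v : N → Finset M → ℝ}
  {s t : AlgState N M}

theorem Rule1Applicable.exists_rule1 (h : Rule1Applicable v s) : ∃ t, Rule1 v s t := by
  obtain ⟨i, hi, j, hj, hij, henv⟩ := h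
  classical
  obtain ⟨S, hS, hmin⟩ := Finset.exists_min_image
    ((relToBoth v s.pool i j).powerset.filter fun T =>
      EnviesSet v s.bundle i T ∨ EnviesSet v s.bundle j T) Finset.card
    ⟨relToBoth v s.pool i j, by simp [henv]⟩
  simp only [Finset.mem_filter, Finset.mem_powerset] at hS hmin
  have hmin' : ∀ T ⊆ relToBoth v s.pool i j,
      EnviesSet v s.bundle i T ∨ EnviesSet v s.bundle j T → S.card ≤ T.card :=
    fun T hT hT' => hmin T ⟨hT, hT'⟩
  rcases hS.2 with h | h
  · exact ⟨_, i, hi, j, hj, hij, henv, S, hS.1, hmin', i, Or.inl rfl, h, rfl⟩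
  · exact ⟨_, i, hi, j, hj, hij, henv, S, hS.1, hmin', j, Or.inr rfl, h, rfl⟩

/-- The rule names as `j` an agent who does not envy the other. If there is no mutual envy, one of
the two orders fits; after a swap that resolves mutual envy, either does. -/
theorem exists_rule3Many {i j : N} (hij : i ≠ j) :
    (∃ t, Rule3Many v s t i j) ∨ ∃ t, Rule3Many v s t j i := by
  have key : ∀ i j : N, i ≠ j → ∀ Z : N → Finset M,
      (EnviesSet v s.bundle i (s.bundle j) ∧ EnviesSet v s.bundle j (s.bundle i) →
        Z = s.bundle ∘ Equiv.swap i j) →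
      (¬ (EnviesSet v s.bundle i (s.bundle j) ∧ EnviesSet v s.bundle j (s.bundle i)) →
        Z = s.bundle) → ¬ EnviesSet v Z j (Z i) → ∃ t, Rule3Many v s t i j := by
    intro i j hij Z hZ hZ' hj
    have hY : ∀ Sj Si : Finset M, ∃ Y : N → Finset M, Y j = Sj ∧ Y i = Si := fun Sj Si =>
      ⟨fun k => if k = j then Sj else Si, by simp, by simp [hij]⟩
    obtain ⟨A, hA⟩ : ∃ A, A = Z i ∪ (relTo v s.pool i \ relToBoth v s.pool i j) := ⟨_, rfl⟩
    obtain ⟨Y, hY⟩ : ∃ Y : N → Finset M,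
        (v j (relTo v s.pool j) ≤ v j (Z j) ∧ Y j = Z j ∧ Y i = A) ∨
        (v j (Z j) ≤ v j (relTo v s.pool j) ∧ v i (Z j) ≤ v i A ∧ Y j = relTo v s.pool j ∧
          Y i = A) ∨
        (v j (Z j) ≤ v j (relTo v s.pool j) ∧ v i A ≤ v i (Z j) ∧ Y j = relTo v s.pool j ∧
          Y i = Z j) := by
      rcases le_total (v j (relTo v s.pool j)) (v j (Z j)) with hCB | hBC
      · obtain ⟨Y, hYj, hYi⟩ := hY (Z j) A
        exact ⟨Y, Or.inl ⟨hCB, hYj, hYi⟩⟩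
      · rcases le_total (v i (Z j)) (v i A) with hBA | hAB
        · obtain ⟨Y, hYj, hYi⟩ := hY (relTo v s.pool j) A
          exact ⟨Y, Or.inr (Or.inl ⟨hBC, hBA, hYj, hYi⟩)⟩
        · obtain ⟨Y, hYj, hYi⟩ := hY (relTo v s.pool j) (Z j)
          exact ⟨Y, Or.inr (Or.inr ⟨hBC, hAB, hYj, hYi⟩)⟩
    refine ⟨_, Z, ?_, hj, A, _, _, hA, rfl, rfl, Y, hY, rfl⟩
    split_ifs with henv
    exacts [hZ henv, hZ' henv]
  by_cases henv : EnviesSet v s.bundle i (s.bundle j) ∧ EnviesSet v s.bundle j (s.bundle i)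
  · refine Or.inl (key i j hij _ (fun _ => rfl) (fun h => absurd henv h) ?_)
    simpa [EnviesSet] using (show v j (s.bundle j) < v j (s.bundle i) from henv.2).le
  · by_cases hj : EnviesSet v s.bundle j (s.bundle i)
    · exact Or.inr (key j i hij.symm s.bundle (fun h => absurd h.symm henv) (fun _ => rfl)
        fun hi => henv ⟨hi, hj⟩)
    · exact Or.inl (key i j hij s.bundle (fun h => absurd h henv) (fun _ => rfl) hj)

theorem RunInvariant.exists_rule3 [Fintype M] (hv : ∀ i, IsAdditiveValuation (v i))
    (h : RunInvariant v s) (h3 : Rule3Applicable v s) : ∃ t, Rule3 v s t := by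
  obtain ⟨i, j, hEij, hEji⟩ := h3
  have hi := hEij.1
  have hj := hEij.2.1
  have hij : i ≠ j := hEij.2.2.1
  by_cases hcard : s.remaining.card = 2
  · have hefx := isApproxEFXOn_one.1 h.invariant.remaining_efx
    obtain ⟨a, b, hd, hU, he1, he2, hvi, hvj⟩ := (hv i).exists_efx_partition (hv j)
      (T := s.bundle i ∪ s.bundle j ∪ s.pool) (h.isPartition.1 i j hij)
      Finset.subset_union_left (hefx i hi j hj hij) (hefx j hj i hi hij.symm)
    obtain ⟨Y, rfl, rfl⟩ : ∃ Y : N → Finset M, a = Y i ∧ b = Y j :=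
      ⟨fun k => if k = i then a else b, by simp, by simp [hij.symm]⟩
    refine ⟨_, i, j, hEij, hEji, Or.inl ⟨hcard, Y, hd, hU, ?_, ?_, hvi, hvj, rfl⟩⟩ <;>
      rwa [not_stronglyEnvies, one_mul]
  · rcases exists_rule3Many (v := v) (s := s) hij with ⟨t, ht⟩ | ⟨t, ht⟩
    · exact ⟨t, i, j, hEij, hEji, Or.inr ⟨hcard, ht⟩⟩
    · exact ⟨t, j, i, hEji, hEij, Or.inr ⟨hcard, ht⟩⟩

variable [Fintype N]

/-- The prescriptions for a good `g` conflict only if it is relevant to both ends of two different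
edges of `τ`. By two-boundedness these edges would join the same two agents in opposite directions,
a 2-cycle, which Rule 3 would have resolved. -/
theorem Rule4Applicable.exists_rule4 (hb : IsBounded v 2 ⊤) (h3 : ¬ Rule3Applicable v s)
    (h4 : Rule4Applicable v s) : ∃ t, Rule4 v s t := by
  classical
  obtain ⟨σ, hσ, hhom⟩ := h4
  obtain ⟨τ, Z, hτZ, hτσ⟩ : ∃ (τ : Equiv.Perm N) (Z : N → Finset M),
      ((s.AllHeavy v σ ∧ τ = σ⁻¹ ∧ Z = s.bundle ∘ σ) ∨
       (s.AllLight v σ ∧ τ = σ ∧ Z = s.bundle)) ∧ (τ = σ ∨ τ = σ⁻¹) := by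
    rcases hhom with h | h
    · exact ⟨_, _, Or.inl ⟨h, rfl, rfl⟩, Or.inr rfl⟩
    · exact ⟨_, _, Or.inr ⟨h, rfl, rfl⟩, Or.inl rfl⟩
  have hne : ∀ i ∈ σ.support, i ≠ τ i := by
    intro i hi
    rw [Equiv.Perm.mem_support] at hi
    rcases hτσ with rfl | rfl
    · exact hi.symm
    · intro h
      exact hi (Equiv.Perm.eq_inv_iff_eq.1 h)
  have hne2 : ∀ i ∈ σ.support, τ (τ i) ≠ i := by
    intro i hi
    rcases hτσ with rfl | rfl
    · exact hσ.apply_apply_ne h3 hi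
    · intro h
      rw [Equiv.Perm.inv_eq_iff_eq, Equiv.Perm.inv_eq_iff_eq] at h
      exact hσ.apply_apply_ne h3 hi h.symm
  have hrg : ∀ g : M, ∃ k : N, (∀ i ∈ σ.support, g ∈ relTo v s.pool i →
        k ∈ σ.support ∧ Relevant v k g) ∧
      ∀ i ∈ σ.support, g ∈ relToBoth v s.pool i (τ i) → k = i := by
    intro g
    by_cases h1 : ∃ i ∈ σ.support, g ∈ relToBoth v s.pool i (τ i)
    · obtain ⟨i, hi, hg⟩ := h1
      rw [mem_relToBoth (hne i hi)] at hg
      refine ⟨i, fun _ _ _ => ⟨hi, hg.2.1⟩, fun k hk hgk => ?_⟩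
      rw [mem_relToBoth (hne k hk)] at hgk
      by_contra hik
      have e1 := (hb.eq_or_eq (hne i hi) hg.2.1 hg.2.2 hgk.2.1).resolve_left (Ne.symm hik)
      have e2 := (hb.eq_or_eq (hne k hk) hgk.2.1 hgk.2.2 hg.2.1).resolve_left hik
      exact hne2 i hi (by rw [← e1, ← e2])
    · by_cases h2 : ∃ i ∈ σ.support, g ∈ relTo v s.pool i
      · obtain ⟨i, hi, hg⟩ := h2
        exact ⟨i, fun _ _ _ => ⟨hi, (mem_relTo.1 hg).2⟩, fun k hk hgk => absurd ⟨k, hk, hgk⟩ h1⟩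
      · obtain ⟨i, -⟩ := hσ.1.nonempty_support
        exact ⟨i, fun k hk hgk => absurd ⟨k, hk, hgk⟩ h2,
          fun k hk hgk => absurd ⟨k, hk, hgk⟩ h1⟩
  choose r hr using hrg
  exact ⟨_, σ, hσ, τ, Z, hτZ, r, fun i hi g hg => (hr g).1 i hi hg,
    fun i hi g hg => (hr g).2 i hi hg, rfl⟩

theorem Rule5Applicable.exists_rule5 (h5 : Rule5Applicable v s) : ∃ t, Rule5 v s t := by
  obtain ⟨σ, hσ, hhet⟩ := h5
  obtain ⟨i, hi, hH, hL⟩ := hσ.exists_heavy_light hhet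
  by_cases hP : v (σ i) (relTo v s.pool (σ i)) ≤ v (σ i) (s.bundle (σ i)) / √2
  · exact ⟨_, σ, hσ, hhet, i, σ i, σ (σ i), hi, rfl, rfl, hH, hL, Or.inl ⟨hP, rfl⟩⟩
  · exact ⟨_, σ, hσ, hhet, i, σ i, σ (σ i), hi, rfl, rfl, hH, hL, Or.inr ⟨hP,
      fun k => if k = i then s.bundle (σ i) ∪ (relTo v s.pool i \ relToBoth v s.pool i (σ i))
        else relTo v s.pool (σ i), by simp [hi], by simp, rfl⟩⟩

variable [Fintype M]

theorem RunInvariant.exists_step (hv : ∀ i, IsAdditiveValuation (v i)) (hb : IsBounded v 2 ⊤)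
    (h : RunInvariant v s) (hs : ¬ AlgHalted v s) : ∃ t, AlgStep v s t := by
  simp only [AlgHalted, not_forall, not_not] at hs
  obtain ⟨k, hk, hmin⟩ := wellFounded_lt.has_min {k : Fin 5 | RuleApplicable v k s} hs
  have hn : ∀ l : Fin 5, l < k → ¬ RuleApplicable v l s := fun l hl hl' => hmin l hl' hl
  suffices ∃ t, ApplyRule v k s t by
    obtain ⟨t, ht⟩ := this
    exact ⟨t, k, hk, hn, ht⟩
  fin_cases k
  · exact Rule1Applicable.exists_rule1 hk
  · obtain ⟨i, hi⟩ : Rule2Applicable v s := hk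
    exact ⟨_, i, hi, rfl⟩
  · exact h.exists_rule3 hv hk
  · exact Rule4Applicable.exists_rule4 hb (hn 2 (by decide)) hk
  · exact Rule5Applicable.exists_rule5 hk

/-- If agents remained without a sink, the successor map would be a permutation, and its cycle
through any of them would trigger Rule 4 or Rule 5. -/
theorem RunInvariant.remaining_eq_empty (hv : ∀ i, IsAdditiveValuation (v i))
    (hb : IsBounded v 2 ⊤) (h : RunInvariant v s) (hs : AlgHalted v s) : s.remaining = ∅ := by
  by_contra hne
  obtain ⟨i₀, hi₀⟩ := Finset.nonempty_iff_ne_empty.2 hne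
  obtain ⟨f, hinj, hf⟩ := h.exists_succ hv hb (hs 1)
  obtain ⟨σ, hσ, hσo⟩ : ∃ σ : Equiv.Perm N, (∀ i : s.remaining, σ i = f i) ∧
      ∀ i ∉ s.remaining, σ i = i :=
    ⟨Equiv.Perm.ofSubtype (Equiv.ofBijective f (Finite.injective_iff_bijective.1 hinj)),
      fun i => by simp, fun i hi => Equiv.Perm.ofSubtype_apply_of_not_mem _ hi⟩
  have hσ' : ∀ i, σ i ≠ i → s.Edge v 0 i (σ i) := by
    intro i hi
    by_cases hir : i ∈ s.remaining
    · have := hf ⟨i, hir⟩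
      rwa [← hσ ⟨i, hir⟩] at this
    · exact absurd (hσo i hir) hi
  have hne₀ : σ i₀ ≠ i₀ := by
    have := hf ⟨i₀, hi₀⟩
    rw [← hσ ⟨i₀, hi₀⟩] at this
    exact this.2.2.1.symm
  have hcyc : s.IsEnvyCycle v (σ.cycleOf i₀) := by
    refine ⟨Equiv.Perm.isCycle_cycleOf σ hne₀, fun i hi => ?_⟩
    have hsame : σ.SameCycle i₀ i := by
      by_contra hns
      exact hi (Equiv.Perm.cycleOf_apply_of_not_sameCycle hns)
    rw [hsame.cycleOf_apply] at hi ⊢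
    exact hσ' i hi
  by_cases hhom : s.AllHeavy v (σ.cycleOf i₀) ∨ s.AllLight v (σ.cycleOf i₀)
  · exact hs 3 ⟨_, hcyc, hhom⟩
  · exact hs 4 ⟨_, hcyc, hhom⟩

end Progress

/-! ### Dummy goods -/

section Padding

variable {N M : Type*} [DecidableEq N] [DecidableEq M]

/-- The valuation `u` extended by a private good of the agent `i`, worth `ε` to her. -/
def padValuation (u : Finset M → ℝ) (i : N) (ε : ℝ) (S : Finset (M ⊕ N)) : ℝ :=
  u S.toLeft + if Sum.inr i ∈ S then ε else 0

theorem IsAdditiveValuation.pad {u : Finset M → ℝ} (hu : IsAdditiveValuation u) (i : N) {ε : ℝ}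
    (hε : 0 ≤ ε) : IsAdditiveValuation (padValuation u i ε) where
  nonneg S := by
    have := hu.nonneg S.toLeft
    unfold padValuation
    positivity
  mono S T hST := by
    unfold padValuation
    refine add_le_add (hu.mono _ _ (Finset.toLeft_subset_toLeft hST)) ?_
    by_cases hS : Sum.inr i ∈ S
    · rw [if_pos hS, if_pos (hST hS)]
    · rw [if_neg hS]
      positivity
  additive S T hST := by
    unfold padValuation
    have hd : Disjoint S.toLeft T.toLeft := by
      rw [Finset.disjoint_left] at hST ⊢
      intro g hg hg'
      exact hST (Finset.mem_toLeft.1 hg) (Finset.mem_toLeft.1 hg')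
    rw [Finset.toLeft_union, hu.additive _ _ hd]
    by_cases hS : Sum.inr i ∈ S <;> by_cases hT : Sum.inr i ∈ T
    · exact absurd hT (Finset.disjoint_left.1 hST hS)
    all_goals simp [hS, hT, add_comm, add_left_comm]

end Padding

/-! ### Returned allocations and the main theorem -/

section Main

variable {N M : Type*} [Fintype N] [DecidableEq N] [Nonempty N] [Fintype M] [DecidableEq M]
  {v : N → Finset M → ℝ}

theorem exists_halted (hv : ∀ i, IsAdditiveValuation (v i)) (hb : IsBounded v 2 ⊤) {f : N → M}
    (hf : IsBasicFeasible v f) : ∃ s, AlgReachable v f s ∧ AlgHalted v s := by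
  by_contra! hno
  have hstep : ∀ s : {s // AlgReachable v f s}, ∃ t : {s // AlgReachable v f s},
      AlgStep v s.1 t.1 := by
    rintro ⟨s, hs⟩
    obtain ⟨t, ht⟩ := (hs.runInvariant hf hv hb).exists_step hv hb (hno s hs)
    exact ⟨⟨t, Relation.ReflTransGen.tail hs ht⟩, ht⟩
  choose next hnext using hstep
  refine no_infinite_run (v := v)
    (fun n => (next^[n] ⟨initState f, Relation.ReflTransGen.refl⟩).1) fun n => ?_
  rw [Function.iterate_succ_apply']
  exact hnext _

theorem exists_returned (hv : ∀ i, IsAdditiveValuation (v i)) (hb : IsBounded v 2 ⊤) {f : N → M}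
    (hf : IsBasicFeasible v f) : ∃ X, AlgReturns v f X := by
  obtain ⟨s, hs, hh⟩ := exists_halted hv hb hf
  have hinv := hs.runInvariant hf hv hb
  obtain ⟨i₀⟩ := ‹Nonempty N›
  obtain ⟨i, hi⟩ := hinv.lastFinalized_nonempty
    ⟨i₀, by rw [hinv.remaining_eq_empty hv hb hh]; simp⟩
  exact ⟨_, s, hs, hh, i, hi, rfl⟩

theorem AlgReturns.complete_and_efx (hv : ∀ i, IsAdditiveValuation (v i)) (hb : IsBounded v 2 ⊤)
    {f : N → M} (hf : IsBasicFeasible v f) {X : N → Finset M} (hX : AlgReturns v f X) :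
    IsCompleteAllocation X ∧ IsApproxEFX v (1 / √2) X := by
  obtain ⟨s, hs, hh, i, hi, rfl⟩ := hX
  have hinv := hs.runInvariant hf hv hb
  have hrem := hinv.remaining_eq_empty hv hb hh
  obtain ⟨p1, p2, p3⟩ := hinv.isPartition
  have hefx := isApproxEFXOn_inv_sqrt_two.1 hinv.invariant.finalized_efx
  have hself : Function.update s.bundle i (s.bundle i ∪ s.pool) i = s.bundle i ∪ s.pool :=
    Function.update_self ..
  have hother : ∀ k, k ≠ i →
      Function.update s.bundle i (s.bundle i ∪ s.pool) k = s.bundle k := fun k hk =>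
    Function.update_of_ne hk ..
  refine ⟨⟨fun k l hkl => ?_, fun g => ?_⟩, ?_⟩
  · by_cases hk : k = i
    · subst hk
      rw [hself, hother l hkl.symm]
      exact Finset.disjoint_union_left.2 ⟨p1 k l hkl, (p2 l).symm⟩
    · by_cases hl : l = i
      · subst hl
        rw [hself, hother k hk]
        exact Finset.disjoint_union_right.2 ⟨p1 k l hkl, p2 k⟩
      · rw [hother k hk, hother l hl]
        exact p1 k l hkl
  · rcases p3 g with hg | ⟨k, hg⟩
    · exact ⟨i, by rw [hself]; exact Finset.mem_union_right _ hg⟩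
    · by_cases hk : k = i
      · subst hk
        exact ⟨k, by rw [hself]; exact Finset.mem_union_left _ hg⟩
      · exact ⟨k, by rwa [hother k hk]⟩
  · refine isApproxEFXOn_inv_sqrt_two.2 fun k _ l _ hkl g hg => ?_
    have hk' : k ∉ s.remaining := by simp [hrem]
    have hl' : l ∉ s.remaining := by simp [hrem]
    by_cases hl : l = i
    · subst hl
      rw [hself] at hg ⊢
      rw [hother k hkl]
      rcases hinv.leftover hrem with hp | hp
      · rw [hp, Finset.union_empty] at hg ⊢
        exact hefx k hk' l hl' hkl g hg
      · exact ((hv k).sdiff_singleton_le _ g).trans (hp l hi k hkl)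
    · rw [hother l hl] at hg ⊢
      refine (hefx k hk' l hl' hkl g hg).trans ?_
      refine mul_le_mul_of_nonneg_left ?_ (Real.sqrt_nonneg _)
      by_cases hk : k = i
      · subst hk
        rw [hself]
        exact (hv k).mono _ _ Finset.subset_union_left
      · rw [hother k hk]

/-- An assignment of maximum Nash welfare has positive welfare because `f` does, so all its factors
are positive and it is basic feasible. -/
theorem exists_complete_efx_of_feasible (hv : ∀ i, IsAdditiveValuation (v i))
    (hb : IsBounded v 2 ⊤) {f : N → M} (hinj : Function.Injective f) (hf : ∀ i, 0 < v i {f i}) :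
    ∃ X : N → Finset M, IsCompleteAllocation X ∧ IsApproxEFX v (1 / √2) X := by
  classical
  obtain ⟨f', hf', hmax⟩ := Finset.exists_max_image
    (Finset.univ.filter fun f' : N → M => Function.Injective f') (nashWelfare v)
    ⟨f, by simpa using hinj⟩
  simp only [Finset.mem_filter, Finset.mem_univ, true_and] at hf' hmax
  have hcard : (0 : ℝ) < 1 / (Fintype.card N : ℝ) := by
    have : 0 < Fintype.card N := Fintype.card_pos
    positivity
  have hpos : 0 < nashWelfare v f' :=
    (Real.rpow_pos_of_pos (Finset.prod_pos fun i _ => hf i) _).trans_le (hmax f hinj)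
  have hbf : IsBasicFeasible v f' := by
    refine ⟨hf', hmax, fun i => lt_of_le_of_ne ((hv i).nonneg _) fun h0 => ?_⟩
    rw [nashWelfare, Finset.prod_eq_zero (Finset.mem_univ i) h0.symm,
      Real.zero_rpow hcard.ne'] at hpos
    exact lt_irrefl _ hpos
  obtain ⟨X, hX⟩ := exists_returned hv hb hbf
  exact ⟨X, hX.complete_and_efx hv hb hbf⟩

theorem exists_complete_efx (hv : ∀ i, IsAdditiveValuation (v i)) (hb : IsBounded v 2 ⊤) :
    ∃ X : N → Finset M, IsCompleteAllocation X ∧ IsApproxEFX v (1 / √2) X := by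
  -- There are finitely many strict inequalities to preserve, each continuous in `ε`, so a small
  -- positive `ε` keeps them all.
  obtain ⟨ε, hgap, hε⟩ : ∃ ε : ℝ, (∀ (i : N) (S T : Finset M),
      √2 * v i S < v i T → √2 * (v i S + ε) < v i T) ∧ 0 < ε := by
    have hev : ∀ᶠ ε in nhdsWithin (0 : ℝ) (Set.Ioi 0), ∀ (i : N) (S T : Finset M),
        √2 * v i S < v i T → √2 * (v i S + ε) < v i T := by
      simp only [Filter.eventually_all]
      intro i S T hlt
      refine Filter.Eventually.filter_mono nhdsWithin_le_nhds ?_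
      have hc : Continuous fun ε : ℝ => √2 * (v i S + ε) := by fun_prop
      exact hc.continuousAt.eventually_lt_const (by simpa using hlt)
    exact (hev.and self_mem_nhdsWithin).exists
  set w : N → Finset (M ⊕ N) → ℝ := fun i => padValuation (v i) i ε with hw
  have hwv : ∀ i, IsAdditiveValuation (w i) := fun i => (hv i).pad i hε.le
  have hrel : ∀ i g, Relevant w i g → (∃ m, g = Sum.inl m ∧ Relevant v i m) ∨ g = Sum.inr i := by
    rintro i (m | k) hr
    · refine Or.inl ⟨m, rfl, ?_⟩
      have : ({Sum.inl m} : Finset (M ⊕ N)).toLeft = {m} := by ext; simp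
      simpa [Relevant, hw, padValuation, this] using hr
    · have : ({Sum.inr k} : Finset (M ⊕ N)).toLeft = ∅ := by ext; simp
      by_contra hne
      have hik : i ≠ k := by
        rintro rfl
        simp at hne
      simp [Relevant, hw, padValuation, this, (hv i).empty, hik] at hr
  have hwb : IsBounded w 2 ⊤ := by
    refine ⟨?_, fun _ _ _ => le_top⟩
    rintro (m | k)
    · refine (Set.encard_le_encard fun i hi => ?_).trans (hb.1 m)
      simpa using hrel i _ hi
    · refine (Set.encard_le_encard (t := {k}) fun i hi => ?_).trans ?_
      · simpa using ((hrel i _ hi).resolve_left (by simp)).symm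
      · rw [Set.encard_singleton]
        norm_num
  -- The dummy goods themselves form a feasible start.
  obtain ⟨X, ⟨hd, hc⟩, hX⟩ := exists_complete_efx_of_feasible hwv hwb (f := Sum.inr)
    Sum.inr_injective fun i => by
      have : ({Sum.inr i} : Finset (M ⊕ N)).toLeft = ∅ := by ext; simp
      simpa [hw, padValuation, this, (hv i).empty] using hε
  refine ⟨fun i => (X i).toLeft, ⟨fun i j hij => ?_, fun g => ?_⟩, ?_⟩
  · rw [Finset.disjoint_left]
    intro g hg hg'
    exact Finset.disjoint_left.1 (hd i j hij) (Finset.mem_toLeft.1 hg) (Finset.mem_toLeft.1 hg')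
  · obtain ⟨i, hi⟩ := hc (Sum.inl g)
    exact ⟨i, Finset.mem_toLeft.2 hi⟩
  · refine isApproxEFXOn_inv_sqrt_two.2 fun i _ j _ hij g hg => ?_
    -- Dropping the dummies costs `i` at most `ε` of her own value and does not raise the value of
    -- the other bundle, so a violation would contradict the choice of `ε`.
    by_contra! hlt
    have h1 := isApproxEFXOn_inv_sqrt_two.1 hX i trivial j trivial hij (Sum.inl g)
      (Finset.mem_toLeft.1 hg)
    have h2 : v i ((X j).toLeft \ {g}) ≤ w i (X j \ {Sum.inl g}) := by
      have hsub : (X j).toLeft \ {g} = (X j \ {Sum.inl g}).toLeft := by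
        ext; simp
      rw [hsub]
      refine le_add_of_nonneg_right ?_
      positivity
    have h3 : w i (X i) ≤ v i (X i).toLeft + ε := by
      refine add_le_add le_rfl ?_
      split_ifs
      exacts [le_rfl, hε.le]
    have h4 := mul_le_mul_of_nonneg_left h3 (Real.sqrt_nonneg 2)
    linarith [hgap i _ _ hlt]

end Main

/-- Every additive `(2, ∞)`-bounded instance has a complete `1/√2`-EFX allocation. Moreover, from
every basic feasible allocation, every run of the algorithm keeps the invariants, never gets stuck,
ends after finitely many updates with all agents finalized, and returns such an allocation. -/
theorem mainTheorem1 {N M : Type*} [Fintype N] [DecidableEq N] [Nonempty N]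
    [Fintype M] [DecidableEq M] (v : N → Finset M → ℝ)
    (hv : ∀ i, IsAdditiveValuation (v i)) (hb : IsBounded v 2 ⊤) :
    (∃ X : N → Finset M, IsCompleteAllocation X ∧ IsApproxEFX v (1 / √2) X) ∧
    ∀ f : N → M, IsBasicFeasible v f →
      (∀ s : AlgState N M, AlgReachable v f s →
        s.IsPartition ∧ AlgInvariant v s ∧
        (AlgHalted v s → s.remaining = ∅) ∧
        (¬ AlgHalted v s → ∃ t : AlgState N M, AlgStep v s t)) ∧
      (¬ ∃ run : ℕ → AlgState N M,
        run 0 = initState f ∧ ∀ n : ℕ, AlgStep v (run n) (run (n + 1))) ∧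
      (∃ X : N → Finset M, AlgReturns v f X) ∧
      (∀ X : N → Finset M, AlgReturns v f X →
        IsCompleteAllocation X ∧ IsApproxEFX v (1 / √2) X) := by
  refine ⟨exists_complete_efx hv hb, fun f hf => ⟨fun s hs => ?_, ?_, exists_returned hv hb hf,
    fun X hX => hX.complete_and_efx hv hb hf⟩⟩
  · have h := hs.runInvariant hf hv hb
    exact ⟨h.isPartition, h.invariant, h.remaining_eq_empty hv hb, h.exists_step hv hb⟩
  · rintro ⟨run, -, hrun⟩
    exact no_infinite_run run hrun
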